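/- Let $\sigma,\lambda>0$ and consider on the whole real line the Fokker--Planck equation $$\partial_t f=\frac{\sigma}{2}\,\partial_v^2\big(v^2 f\big)+\lambda\,\partial_v\big((v-1)f\big),\qquad v\in\mathbb{R},\ t>0. \tag{1}$$ Let $f_0\in L^1\cap L^\infty(\mathbb{R})$ be a probability density with unit mean, i.e. $f_0\ge 0$ a.e., $\int_{\mathbb{R}} f_0\,dv=1$, $\int_{\mathbb R}|v|f_0\,dv<\infty$ and $\int_{\mathbb{R}} v f_0\,dv=1$. Let $f$ be the solution of (1) with initial value $f_0$ in the class $f\in L^\infty([0,T],L^1\cap L^\infty(\mathbb R))$, $v\,\partial_v f\in L^2([0,T],L^2(\mathbb R))$ for every $T>0$, in the weak sense: for all $\varphi\in C_c^\infty(\mathbb{R})$ and all $t\ge 0$, $$\int_{\mathbb R}\varphi\, f(v,t)\,dv=\int_{\mathbb R}\varphi\, f_0\,dv+\int_0^t\!\int_{\mathbb R}\Big[\frac{\sigma}{2}v^2\varphi''(v)-\lambda(v-1)\varphi'(v)\Big]f(v,s)\,dv\,ds .$$ (Here $f$ denotes the representative for which this holds, and the $L^1\cap L^\infty$ bound holds,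 at every time.) Put $$\rho_+(t)=\int_0^{\infty} f(v,t)\,dv,\qquad m_-(t)=\int_{-\infty}^0 v f(v,t)\,dv .$$ Then: 1. For every $t\ge0$, $f(\cdot,t)$ is a probability density with unit mean: $f(\cdot,t)\ge0$ a.e., $\int_{\mathbb R} f(v,t)\,dv=1$, $\int_{\mathbb R}|v|f(v,t)\,dv<\infty$, and $\int_{\mathbb R} v f(v,t)\,dv=1$. 2. The mass $\rho_+(t)$ is nondecreasing on $[0,\infty)$. For almost every $s>0$ the value $f(0,s):=\lim_{\varepsilon\to0^+}\frac1{2\varepsilon}\int_{-\varepsilon}^{\varepsilon}f(v,s)\,dv$ exists, $s\mapsto f(0,s)$ is integrable on $[0,t]$ for every $t\ge 0$, and $$\rho_+(t)=\rho_+(0)+\lambda\int_0^t f(0,s)\,ds\qquad\text{for all } t\ge0 .$$ 3. $|m_-(t)|$ is nonincreasing on $[0,\infty)$, and $|m_-(t)|\le |m_-(0)|\,e^{-\lambda t}$ for all $t\ge0$. -/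

import Mathlib

open MeasureTheory Set Filter Topology
open scoped ContDiff

namespace WealthFP

/-- `g` is (a.e. equal to) a probability density on `ℝ` with unit mean:
`g ≥ 0` a.e., `∫ g = 1`, and `∫ v g(v) dv = 1` with the integral absolutely convergent. -/
structure IsUnitMeanDensity (g : ℝ → ℝ) : Prop where
  nonneg : ∀ᵐ v, 0 ≤ g v
  integrable : Integrable g
  mass : ∫ v, g v = 1
  integrable_mul : Integrable (fun v => v * g v)
  mean : ∫ v, v * g v = 1

/-- Smooth compactly supported real test functions on the line. -/
def IsTest (φ : ℝ → ℝ) : Prop := ContDiff ℝ ∞ φ ∧ HasCompactSupport φ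

/-- The formal adjoint of `J(h) = (σ/2) (v² h)'' + λ ((v - 1) h)'` applied to a test function:
`(σ/2) v² φ'' - λ (v - 1) φ'`. -/
noncomputable def adjointJ (σ lam : ℝ) (φ : ℝ → ℝ) (v : ℝ) : ℝ :=
  σ / 2 * v ^ 2 * deriv (deriv φ) v - lam * (v - 1) * deriv φ v

/-- `g` represents the distribution `v ∂ᵥ h` on the whole line:
`∫ g φ = - ∫ h (v φ)'` for all test functions. -/
def IsMulWeakDeriv (h g : ℝ → ℝ) : Prop :=
  ∀ φ : ℝ → ℝ, IsTest φ → ∫ v, g v * φ v = - ∫ v, h v * (φ v + v * deriv φ v)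

/-- `f` (time first, `f t v`) is a solution on `[0, T]`, with initial datum `f₀`, of
`∂ₜ f = (σ/2) ∂ᵥ²(v² f) + λ ∂ᵥ((v - 1) f)` on the whole line, in the class
`f ∈ L^∞([0,T], L¹ ∩ L^∞)`, `v ∂ᵥ f ∈ L²([0,T], L²)`.
The time-integrated weak equation is required at every time, so `f` is the representative for
which `t ↦ ∫ φ f(t)` is continuous, and `f 0 = f₀` almost everywhere. -/
structure IsSolutionOn (σ lam T : ℝ) (f₀ : ℝ → ℝ) (f : ℝ → ℝ → ℝ) : Prop where
  measurable : AEStronglyMeasurable (Function.uncurry f)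
    ((volume.restrict (Icc 0 T)).prod volume)
  bounded : ∃ C : ℝ, ∀ t ∈ Icc 0 T,
    Integrable (f t) ∧ (∫ v, |f t v|) ≤ C ∧ ∀ᵐ v, |f t v| ≤ C
  energy : ∃ g : ℝ → ℝ → ℝ,
    MemLp (Function.uncurry g) 2 ((volume.restrict (Icc 0 T)).prod volume) ∧
    ∀ᵐ s ∂(volume.restrict (Icc 0 T)), IsMulWeakDeriv (f s) (g s)
  weak : ∀ φ : ℝ → ℝ, IsTest φ → ∀ t ∈ Icc 0 T,
    ∫ v, φ v * f t v = (∫ v, φ v * f₀ v) + ∫ s in 0..t, ∫ v, adjointJ σ lam φ v * f s v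

/-- A solution on `[0, ∞)`: a solution on `[0, T]` for every `T > 0`. -/
def IsSolution (σ lam : ℝ) (f₀ : ℝ → ℝ) (f : ℝ → ℝ → ℝ) : Prop :=
  ∀ T : ℝ, 0 < T → IsSolutionOn σ lam T f₀ f

/-- The mass `∫₀^∞ g` on the positive half-line. -/
noncomputable def massPos (g : ℝ → ℝ) : ℝ := ∫ v in Ioi 0, g v

/-- The part `∫_{-∞}^0 v g(v) dv` of the mean located on the negative half-line. -/
noncomputable def meanNeg (g : ℝ → ℝ) : ℝ := ∫ v in Iio 0, v * g v

/-- `a` is the value at `x` of the (a.e. class of the) locally integrable function `g`, in the sense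
of its precise representative: the limit of the averages of `g` over `[x - ε, x + ε]`. If `g` agrees
a.e. with a function continuous at `x`, this is the value of that function at `x`. -/
def HasValueAt (g : ℝ → ℝ) (x a : ℝ) : Prop :=
  Tendsto (fun ε : ℝ => (2 * ε)⁻¹ * ∫ v in (x - ε)..(x + ε), g v) (𝓝[>] 0) (𝓝 a)

end WealthFP

/-!
The process with generator `adjointJ` is `dV = λ (1 - V) dt + √σ V dW`: its noise vanishes at the
origin, where the drift pushes to the right with speed `λ`. All the assertions come from inserting
suitable functions into the weak equation.

*Admissible test functions.* Dominated convergence and cutoffs `χ (v / n)` extend the weak equation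
to smooth `φ` for which `φ`, `(1 + |v|) φ'` and `v² φ''` are bounded by a weight which the solution
integrates uniformly in time (`weakPairOn_of_weight`).

*Positivity* (`IsSolutionOn.ae_nonneg`). For a test function `φ ≥ 0` consider
`u (t, y, B) = ∫ φ (e^y v + B) f t v dv`. On the functions `v ↦ φ (e^y v + B)` the generator acts as
a differential operator in the parameters `(y, B)`, so `u` is a classical bounded solution of
`∂ₜ u = (σ / 2) (∂_y² u - ∂_y u) - λ ∂_y u + λ e^y ∂_B u`. The maximum principle (`nonneg_of_pde`)
gives `u ≥ 0`, in particular `∫ φ f t ≥ 0`. This replaces solving the dual equation.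

*Mass and mean* (`IsSolutionOn.isUnitMeanDensity`). The test function `1` gives the mass; concave
truncations of `√(1 + v²)`, on which the generator is bounded above, give a first moment; then the
test function `v - 1`, an eigenfunction of the generator, gives the mean.

*Mass on the positive half-line.* Testing with smooth steps of width `δ → 0` at the origin, the
diffusion disappears and `0 ≤ ρ₊(t) - ρ₊(s) ≤ L (t - s)` (`IsSolutionOn.massPos_sub_mem`). Hence `ρ₊`
is the integral of its derivative. To identify the derivative with `λ f(0, s)`, follow a step along
the line `c' = λ` through the origin: at distance `ε` the diffusion is of order `ε²`, so with a step
of width `ε ^ (3 / 2)` the mass right of `-ε` at time `s` equals `ρ₊(s + ε / λ)`, and the mass right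
of `ε` equals `ρ₊(s - ε / λ)`, up to `O(ε ^ (3 / 2))` (`IsSolutionOn.exists_transport_bound`). So the
averages of `f s` over `[-ε, ε]` converge wherever `ρ₊` is differentiable
(`IsSolution.hasValueAt`), which is almost everywhere by monotonicity.

*Negative part of the mean.* The function `v⁻` is tested through `(√(v² + ε²) - v) / 2`, whose
diffusion term tends to zero; the generator sends `v⁻` to `λ (v - 1) 1_{v < 0} ≤ -λ v⁻`, whence
`|m₋(t)| (1 + λ (t - s)) ≤ |m₋(s)|` for `s ≤ t`. Iterating over `n` equal steps and letting `n → ∞`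
gives the exponential rate (`mul_exp_le_of_implicit_euler`).
-/

namespace WealthFP

variable {σ lam T : ℝ} {f₀ : ℝ → ℝ} {f : ℝ → ℝ → ℝ} {φ : ℝ → ℝ}

/-! ### Test functions -/

theorem IsTest.continuous (h : IsTest φ) : Continuous φ := h.1.continuous

theorem IsTest.exists_bound (h : IsTest φ) : ∃ K, ∀ v, |φ v| ≤ K := by
  simpa using h.2.exists_bound_of_continuous h.1.continuous

theorem contDiff_deriv (h : ContDiff ℝ ∞ φ) : ContDiff ℝ ∞ (deriv φ) :=
  (contDiff_infty_iff_deriv.1 h).2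

theorem IsTest.isTest_deriv (h : IsTest φ) : IsTest (deriv φ) :=
  ⟨contDiff_deriv h.1, h.2.deriv⟩

theorem IsTest.smooth_mul {ψ : ℝ → ℝ} (hψ : ContDiff ℝ ∞ ψ) (h : IsTest φ) :
    IsTest (fun v => ψ v * φ v) :=
  ⟨hψ.mul h.1, h.2.mul_left⟩

theorem IsTest.sub {ψ : ℝ → ℝ} (h : IsTest φ) (hψ : IsTest ψ) :
    IsTest (fun v => φ v - ψ v) :=
  ⟨h.1.sub hψ.1, h.2.sub hψ.2⟩

theorem IsTest.comp_affine {a : ℝ} (ha : a ≠ 0) (b : ℝ) (h : IsTest φ) :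
    IsTest (fun v => φ (a * v + b)) := by
  refine ⟨h.1.comp (by fun_prop), ?_⟩
  exact h.2.comp_homeomorph ((Homeomorph.mulLeft₀ a ha).trans (Homeomorph.addRight b))

theorem isTest_adjointJ_of_deriv (h : ContDiff ℝ ∞ φ) (hc : HasCompactSupport (deriv φ)) :
    IsTest (adjointJ σ lam φ) := by
  have h1 : IsTest (deriv φ) := ⟨contDiff_deriv h, hc⟩
  exact (h1.isTest_deriv.smooth_mul (ψ := fun v => σ / 2 * v ^ 2) (by fun_prop)).sub
    (h1.smooth_mul (ψ := fun v => lam * (v - 1)) (by fun_prop))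

theorem IsTest.isTest_adjointJ (h : IsTest φ) : IsTest (adjointJ σ lam φ) :=
  isTest_adjointJ_of_deriv h.1 h.isTest_deriv.2

/-! ### Pairings with the solution -/

/-- A uniform bound, for times in `[0, T]`, on the integrals of `f t` against the weight `W`. -/
def WeightBoundOn (T : ℝ) (f : ℝ → ℝ → ℝ) (W : ℝ → ℝ) (C : ℝ) : Prop :=
  ∀ s ∈ Icc 0 T, Integrable (fun v => W v * |f s v|) ∧ ∫ v, W v * |f s v| ≤ C

/-- The pair `(φ, g)` satisfies the weak equation on `[0, T]`, with `g` in the place of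
`adjointJ σ lam φ` and `f 0` as initial datum. -/
def WeakPairOn (T : ℝ) (f : ℝ → ℝ → ℝ) (φ g : ℝ → ℝ) : Prop :=
  ∀ t ∈ Icc 0 T, ∫ v, φ v * f t v = (∫ v, φ v * f 0 v) + ∫ s in 0..t, ∫ v, g v * f s v

theorem IsSolutionOn.integrable (hf : IsSolutionOn σ lam T f₀ f) {t : ℝ} (ht : t ∈ Icc 0 T) :
    Integrable (f t) := by
  obtain ⟨C, hC⟩ := hf.bounded
  exact (hC t ht).1

theorem integrable_mul_of_weight {W g : ℝ → ℝ} {C K t : ℝ} (hf : IsSolutionOn σ lam T f₀ f)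
    (hW : WeightBoundOn T f W C) (hg : Measurable g) (hgK : ∀ v, |g v| ≤ K * W v)
    (ht : t ∈ Icc 0 T) : Integrable (fun v => g v * f t v) := by
  refine ((hW t ht).1.const_mul K).mono
    (hg.aestronglyMeasurable.mul (hf.integrable ht).aestronglyMeasurable) (ae_of_all _ fun v => ?_)
  rw [Real.norm_eq_abs, abs_mul, Real.norm_eq_abs, ← mul_assoc]
  exact (mul_le_mul_of_nonneg_right (hgK v) (abs_nonneg _)).trans (le_abs_self _)

theorem abs_integral_mul_le_of_weight {W g : ℝ → ℝ} {C K t : ℝ}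
    (hW : WeightBoundOn T f W C) (hK : 0 ≤ K) (hgK : ∀ v, |g v| ≤ K * W v)
    (ht : t ∈ Icc 0 T) : |∫ v, g v * f t v| ≤ K * C := by
  have h1 : |∫ v, g v * f t v| ≤ ∫ v, K * (W v * |f t v|) := by
    rw [← Real.norm_eq_abs]
    refine norm_integral_le_of_norm_le ((hW t ht).1.const_mul K) (ae_of_all _ fun v => ?_)
    rw [Real.norm_eq_abs, abs_mul, ← mul_assoc]
    exact mul_le_mul_of_nonneg_right (hgK v) (abs_nonneg _)
  rw [integral_const_mul] at h1
  exact h1.trans (mul_le_mul_of_nonneg_left (hW t ht).2 hK)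

theorem aestronglyMeasurable_pairing {g : ℝ → ℝ} (hf : IsSolutionOn σ lam T f₀ f)
    (hg : Measurable g) : AEStronglyMeasurable (fun s => ∫ v, g v * f s v)
      (volume.restrict (Icc 0 T)) := by
  have : AEStronglyMeasurable (fun p : ℝ × ℝ => g p.2 * Function.uncurry f p)
      ((volume.restrict (Icc 0 T)).prod volume) :=
    (hg.comp measurable_snd).aestronglyMeasurable.mul hf.measurable
  exact this.integral_prod_right'

theorem intervalIntegrable_pairing {W g : ℝ → ℝ} {C K : ℝ} (hf : IsSolutionOn σ lam T f₀ f)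
    (hW : WeightBoundOn T f W C) (hK : 0 ≤ K) (hg : Measurable g) (hgK : ∀ v, |g v| ≤ K * W v)
    {s t : ℝ} (hs : s ∈ Icc 0 T) (ht : t ∈ Icc 0 T) :
    IntervalIntegrable (fun r => ∫ v, g v * f r v) volume s t := by
  have hI : IntegrableOn (fun r => ∫ v, g v * f r v) (Icc 0 T) := by
    refine Integrable.of_bound (aestronglyMeasurable_pairing hf hg) (K * C) ?_
    filter_upwards [ae_restrict_mem measurableSet_Icc] with r hr
    exact abs_integral_mul_le_of_weight hW hK hgK hr
  exact (hI.mono_set (uIcc_subset_Icc hs ht)).intervalIntegrable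

theorem IsSolutionOn.exists_weightBoundOn_one (hf : IsSolutionOn σ lam T f₀ f) :
    ∃ C, 0 ≤ C ∧ WeightBoundOn T f (fun _ => 1) C := by
  obtain ⟨C, hC⟩ := hf.bounded
  refine ⟨max C 0, le_max_right _ _, fun s hs => ⟨?_, ?_⟩⟩
  · simpa using (hC s hs).1.abs
  · simpa using Or.inl (hC s hs).2.1

/-- The weak equation from `f 0` on implies the one between any two times. -/
theorem WeakPairOn.sub_eq {W g : ℝ → ℝ} {C K : ℝ} (h : WeakPairOn T f φ g)
    (hf : IsSolutionOn σ lam T f₀ f)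
    (hW : WeightBoundOn T f W C) (hK : 0 ≤ K) (hg : Measurable g) (hgK : ∀ v, |g v| ≤ K * W v)
    {s t : ℝ} (hs : s ∈ Icc 0 T) (ht : t ∈ Icc 0 T) :
    (∫ v, φ v * f t v) - ∫ v, φ v * f s v = ∫ r in s..t, ∫ v, g v * f r v := by
  have h0 : (0 : ℝ) ∈ Icc 0 T := ⟨le_rfl, hs.1.trans hs.2⟩
  rw [h t ht, h s hs, ← intervalIntegral.integral_interval_sub_left
    (intervalIntegrable_pairing hf hW hK hg hgK h0 ht)
    (intervalIntegrable_pairing hf hW hK hg hgK h0 hs)]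
  ring

/-- Dominated limits of pairs satisfying the weak equation satisfy it. -/
theorem WeakPairOn.of_tendsto {W g : ℝ → ℝ} {C K : ℝ} {φs gs : ℕ → ℝ → ℝ}
    (hf : IsSolutionOn σ lam T f₀ f) (hW : WeightBoundOn T f W C) (hK : 0 ≤ K)
    (h : ∀ n, WeakPairOn T f (φs n) (gs n))
    (hφs : ∀ n, Measurable (φs n)) (hgs : ∀ n, Measurable (gs n))
    (hφK : ∀ n v, |φs n v| ≤ K * W v) (hgK : ∀ n v, |gs n v| ≤ K * W v)
    (hφ : ∀ᵐ v, Tendsto (fun n => φs n v) atTop (𝓝 (φ v)))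
    (hg : ∀ᵐ v, Tendsto (fun n => gs n v) atTop (𝓝 (g v))) :
    WeakPairOn T f φ g := by
  have key : ∀ {ψs : ℕ → ℝ → ℝ} {ψ : ℝ → ℝ}, (∀ n, Measurable (ψs n)) →
      (∀ n v, |ψs n v| ≤ K * W v) → (∀ᵐ v, Tendsto (fun n => ψs n v) atTop (𝓝 (ψ v))) →
      ∀ s ∈ Icc 0 T, Tendsto (fun n => ∫ v, ψs n v * f s v) atTop (𝓝 (∫ v, ψ v * f s v)) := by
    intro ψs ψ hm hb hl s hs
    refine tendsto_integral_of_dominated_convergence (fun v => K * (W v * |f s v|))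
      (fun n => (hm n).aestronglyMeasurable.mul (hf.integrable hs).aestronglyMeasurable)
      ((hW s hs).1.const_mul K) (fun n => ae_of_all _ fun v => ?_) ?_
    · rw [Real.norm_eq_abs, abs_mul, ← mul_assoc]
      exact mul_le_mul_of_nonneg_right (hb n v) (abs_nonneg _)
    · filter_upwards [hl] with v hv using hv.mul_const _
  intro t ht
  have h0 : (0 : ℝ) ∈ Icc 0 T := ⟨le_rfl, ht.1.trans ht.2⟩
  have hsub : uIoc 0 t ⊆ Icc 0 T := by
    rw [uIoc_of_le ht.1]; exact fun x hx => ⟨hx.1.le, hx.2.trans ht.2⟩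
  have hint : Tendsto (fun n => ∫ s in 0..t, ∫ v, gs n v * f s v) atTop
      (𝓝 (∫ s in 0..t, ∫ v, g v * f s v)) := by
    refine intervalIntegral.tendsto_integral_filter_of_dominated_convergence (fun _ => K * C)
      (Eventually.of_forall fun n => ?_) (Eventually.of_forall fun n => ae_of_all _ fun s hs => ?_)
      (by simp) (ae_of_all _ fun s hs => key hgs hgK hg s (hsub hs))
    · exact (aestronglyMeasurable_pairing hf (hgs n)).mono_set hsub
    · exact abs_integral_mul_le_of_weight hW hK (hgK n) (hsub hs)
  refine tendsto_nhds_unique (key hφs hφK hφ t ht) ?_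
  simp_rw [fun n => h n t ht]
  exact (key hφs hφK hφ 0 h0).add hint

theorem IsTest.weakPairOn (h : IsTest φ) (hf : IsSolutionOn σ lam T f₀ f) :
    WeakPairOn T f φ (adjointJ σ lam φ) := by
  intro t ht
  have h0 : (0 : ℝ) ∈ Icc 0 T := ⟨le_rfl, ht.1.trans ht.2⟩
  rw [hf.weak φ h t ht, hf.weak φ h 0 h0]
  simp

theorem IsSolutionOn.initial_ae_eq (hf : IsSolutionOn σ lam T f₀ f) (hT : 0 ≤ T)
    (hf₀ : Integrable f₀) : f 0 =ᵐ[volume] f₀ := by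
  obtain ⟨C, hC⟩ := hf.bounded
  have h0 : (0 : ℝ) ∈ Icc 0 T := ⟨le_rfl, hT⟩
  refine ae_eq_of_integral_contDiff_smul_eq (hC 0 h0).1.locallyIntegrable
    hf₀.locallyIntegrable fun φ hφ hc => ?_
  simpa using hf.weak φ ⟨hφ, hc⟩ 0 h0

theorem measurable_adjointJ (h : ContDiff ℝ ∞ φ) : Measurable (adjointJ σ lam φ) := by
  have h1 := (contDiff_deriv h).continuous
  have h2 := (contDiff_deriv (contDiff_deriv h)).continuous
  unfold adjointJ
  exact Continuous.measurable (by fun_prop)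

theorem hasDerivAt_of_smooth (h : ContDiff ℝ ∞ φ) (v : ℝ) : HasDerivAt φ (deriv φ v) v :=
  ((h.differentiable (by simp)) v).hasDerivAt

/-- The operator `adjointJ` computed from given first and second derivatives. -/
theorem adjointJ_eq {φ φ' φ'' : ℝ → ℝ} (h1 : ∀ v, HasDerivAt φ (φ' v) v)
    (h2 : ∀ v, HasDerivAt φ' (φ'' v) v) (v : ℝ) :
    adjointJ σ lam φ v = σ / 2 * v ^ 2 * φ'' v - lam * (v - 1) * φ' v := by
  have e : deriv φ = φ' := funext fun v => (h1 v).deriv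
  rw [adjointJ, e, (h2 v).deriv]

theorem abs_adjointJ_le {W : ℝ → ℝ} {K : ℝ} (b1 : ∀ v, (1 + |v|) * |deriv φ v| ≤ K * W v)
    (b2 : ∀ v, v ^ 2 * |deriv (deriv φ) v| ≤ K * W v) (v : ℝ) :
    |adjointJ σ lam φ v| ≤ (|σ / 2| + |lam|) * K * W v := by
  have h1 : |σ / 2 * v ^ 2 * deriv (deriv φ) v| ≤ |σ / 2| * (K * W v) := by
    rw [abs_mul, abs_mul, abs_of_nonneg (sq_nonneg v), mul_assoc]
    exact mul_le_mul_of_nonneg_left (b2 v) (abs_nonneg _)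
  have h2 : |lam * (v - 1) * deriv φ v| ≤ |lam| * (K * W v) := by
    rw [abs_mul, abs_mul, mul_assoc]
    refine mul_le_mul_of_nonneg_left (le_trans ?_ (b1 v)) (abs_nonneg _)
    refine mul_le_mul_of_nonneg_right ?_ (abs_nonneg _)
    have := abs_sub v 1
    rw [abs_one] at this
    linarith
  refine (abs_sub _ _).trans ?_
  linarith

/-- The weak equation holds for smooth functions without compact support, as soon as they and
their scale-invariant derivatives are controlled by a weight which the solution integrates. -/
theorem weakPairOn_of_weight {W : ℝ → ℝ} {C K : ℝ} (hf : IsSolutionOn σ lam T f₀ f)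
    (hW : WeightBoundOn T f W C) (hφ : ContDiff ℝ ∞ φ) (hK : 0 ≤ K)
    (b0 : ∀ v, |φ v| ≤ K * W v) (b1 : ∀ v, (1 + |v|) * |deriv φ v| ≤ K * W v)
    (b2 : ∀ v, v ^ 2 * |deriv (deriv φ) v| ≤ K * W v) :
    WeakPairOn T f φ (adjointJ σ lam φ) := by
  let χ : ContDiffBump (0 : ℝ) := ⟨1, 2, one_pos, one_lt_two⟩
  have hχ : IsTest χ := ⟨χ.contDiff, χ.hasCompactSupport⟩
  have hχ0 : χ 0 = 1 := χ.one_of_mem_closedBall (by simp [χ])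
  obtain ⟨M₀, hM₀⟩ := hχ.exists_bound
  obtain ⟨M₁, hM₁⟩ := hχ.isTest_deriv.exists_bound
  obtain ⟨M₂, hM₂⟩ := (hχ.isTest_deriv.smooth_mul (ψ := fun x => x) (by fun_prop)).exists_bound
  obtain ⟨M₃, hM₃⟩ := (hχ.isTest_deriv.isTest_deriv.smooth_mul (ψ := fun x => x ^ 2) (by fun_prop)).exists_bound
  have hc0 := hχ.continuous
  have hc1 := hχ.isTest_deriv.continuous
  have hc2 := hχ.isTest_deriv.isTest_deriv.continuous
  have nM₀ := (abs_nonneg _).trans (hM₀ 0)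
  have nM₁ := (abs_nonneg _).trans (hM₁ 0)
  have nM₂ := (abs_nonneg _).trans (hM₂ 0)
  have nM₃ := (abs_nonneg _).trans (hM₃ 0)
  have hbase : ∀ v, 0 ≤ K * W v := fun v => (abs_nonneg _).trans (b0 v)
  let a : ℕ → ℝ := fun n => 1 / ((n : ℝ) + 1)
  have ha : Tendsto a atTop (𝓝 0) := tendsto_one_div_add_atTop_nhds_zero_nat
  have ha0 : ∀ n, 0 < a n := fun n => by positivity
  have ha1 : ∀ n, a n ≤ 1 := fun n => by
    rw [div_le_one (by positivity)]; linarith [Nat.cast_nonneg (α := ℝ) n]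
  let φs : ℕ → ℝ → ℝ := fun n v => φ v * χ (a n * v + 0)
  have hφs : ∀ n, IsTest (φs n) := fun n => (hχ.comp_affine (ha0 n).ne' 0).smooth_mul hφ
  -- The generator applied to the truncation at scale `1 / α`. It depends continuously on `α`, and
  -- at `α = 0` it is the generator applied to `φ`.
  let G : ℝ → ℝ → ℝ := fun α v =>
    χ (α * v) * adjointJ σ lam φ v
      + (σ / 2) * ((α * v) ^ 2 * deriv (deriv χ) (α * v)) * φ v
      + σ * ((α * v) * deriv χ (α * v)) * (v * deriv φ v)
      - lam * (((α * v) * deriv χ (α * v)) - α * deriv χ (α * v)) * φ v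
  have hG : ∀ n v, adjointJ σ lam (φs n) v = G (a n) v := by
    intro n v
    have d0 : ∀ v, HasDerivAt (fun v => a n * v + 0) (a n) v := fun v => by
      simpa using ((hasDerivAt_id v).const_mul (a n)).add_const 0
    have d1 : ∀ v, HasDerivAt (φs n)
        (deriv φ v * χ (a n * v + 0) + φ v * (deriv χ (a n * v + 0) * a n)) v := fun v =>
      (hasDerivAt_of_smooth hφ v).mul ((hasDerivAt_of_smooth hχ.1 _).comp v (d0 v))
    have d2 : ∀ v, HasDerivAt
        (fun v => deriv φ v * χ (a n * v + 0) + φ v * (deriv χ (a n * v + 0) * a n))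
        ((deriv (deriv φ) v * χ (a n * v + 0) + deriv φ v * (deriv χ (a n * v + 0) * a n)) +
        (deriv φ v * (deriv χ (a n * v + 0) * a n)
          + φ v * (deriv (deriv χ) (a n * v + 0) * a n * a n))) v := fun v =>
      ((hasDerivAt_of_smooth (contDiff_deriv hφ) v).mul
        ((hasDerivAt_of_smooth hχ.1 _).comp v (d0 v))).add
      ((hasDerivAt_of_smooth hφ v).mul
        (((hasDerivAt_of_smooth hχ.isTest_deriv.1 _).comp v (d0 v)).mul_const _))
    rw [adjointJ_eq d1 d2]
    simp only [G, adjointJ, add_zero]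
    ring
  have hGcont : ∀ v, Tendsto (fun n => G (a n) v) atTop (𝓝 (adjointJ σ lam φ v)) := by
    intro v
    have : Continuous (fun α => G α v) := by fun_prop
    have h0 : G 0 v = adjointJ σ lam φ v := by simp [G, hχ0]
    rw [← h0]
    exact (this.tendsto 0).comp ha
  have hGK : ∀ n v, |G (a n) v| ≤ ((|σ / 2| + |lam|) * M₀ + |σ / 2| * M₃ + |σ| * M₂
      + |lam| * (M₂ + M₁)) * K * W v := by
    intro n v
    have hv := hbase v
    have e1 : |χ (a n * v) * adjointJ σ lam φ v| ≤ M₀ * ((|σ / 2| + |lam|) * K * W v) := by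
      rw [abs_mul]
      exact mul_le_mul (hM₀ _) (abs_adjointJ_le b1 b2 v) (abs_nonneg _) nM₀
    have e2 : |(σ / 2) * ((a n * v) ^ 2 * deriv (deriv χ) (a n * v)) * φ v|
        ≤ |σ / 2| * M₃ * (K * W v) := by
      rw [abs_mul, abs_mul]
      exact mul_le_mul (mul_le_mul_of_nonneg_left (hM₃ _) (abs_nonneg _)) (b0 v)
        (abs_nonneg _) (by positivity)
    have e3 : |σ * ((a n * v) * deriv χ (a n * v)) * (v * deriv φ v)|
        ≤ |σ| * M₂ * (K * W v) := by
      rw [abs_mul, abs_mul]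
      refine mul_le_mul (mul_le_mul_of_nonneg_left (hM₂ _) (abs_nonneg _)) ?_
        (abs_nonneg _) (by positivity)
      rw [abs_mul]
      refine le_trans ?_ (b1 v)
      exact mul_le_mul_of_nonneg_right (by linarith) (abs_nonneg _)
    have e4 : |lam * (((a n * v) * deriv χ (a n * v)) - a n * deriv χ (a n * v)) * φ v|
        ≤ |lam| * (M₂ + M₁) * (K * W v) := by
      rw [abs_mul, abs_mul]
      refine mul_le_mul (mul_le_mul_of_nonneg_left ?_ (abs_nonneg _)) (b0 v)
        (abs_nonneg _) (by positivity)
      refine (abs_sub _ _).trans (add_le_add (hM₂ _) ?_)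
      rw [abs_mul, abs_of_pos (ha0 n)]
      calc _ ≤ 1 * |deriv χ (a n * v)| := mul_le_mul_of_nonneg_right (ha1 n) (abs_nonneg _)
        _ ≤ M₁ := by rw [one_mul]; exact hM₁ _
    calc _ ≤ _ := (abs_sub _ _).trans
          (add_le_add ((abs_add_le _ _).trans (add_le_add ((abs_add_le _ _).trans
            (add_le_add e1 e2)) e3)) e4)
      _ = _ := by ring
  set L := (|σ / 2| + |lam|) * M₀ + |σ / 2| * M₃ + |σ| * M₂ + |lam| * (M₂ + M₁) with hL
  have nL : 0 ≤ L := by positivity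
  refine WeakPairOn.of_tendsto (φs := φs) (gs := fun n => adjointJ σ lam (φs n))
    (K := (M₀ + L) * K) hf hW (by positivity) (fun n => (hφs n).weakPairOn hf)
    (fun n => (hφs n).continuous.measurable) (fun n => measurable_adjointJ (hφs n).1) ?_ ?_ ?_ ?_
  · intro n v
    have : |φs n v| ≤ (K * W v) * M₀ := by
      simp only [φs]
      rw [abs_mul]
      exact mul_le_mul (b0 v) (hM₀ _) (abs_nonneg _) (hbase v)
    nlinarith [hbase v, mul_nonneg nL (hbase v)]
  · intro n v
    rw [hG]
    refine (hGK n v).trans ?_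
    nlinarith [hbase v, mul_nonneg nM₀ (hbase v)]
  · refine ae_of_all _ fun v => ?_
    have : Continuous (fun α => φ v * χ (α * v + 0)) := by fun_prop
    have h2 := (this.tendsto 0).comp ha
    simpa [hχ0, Function.comp_def, φs] using h2
  · refine ae_of_all _ fun v => ?_
    simp_rw [hG]
    exact hGcont v

theorem WeakPairOn.abs_sub_le {W g : ℝ → ℝ} {C K : ℝ} (h : WeakPairOn T f φ g)
    (hf : IsSolutionOn σ lam T f₀ f)
    (hW : WeightBoundOn T f W C) (hK : 0 ≤ K) (hg : Measurable g) (hgK : ∀ v, |g v| ≤ K * W v)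
    {s t : ℝ} (hs : s ∈ Icc 0 T) (ht : t ∈ Icc 0 T) :
    |(∫ v, φ v * f t v) - ∫ v, φ v * f s v| ≤ K * C * |t - s| := by
  rw [h.sub_eq hf hW hK hg hgK hs ht]
  rw [← Real.norm_eq_abs]
  refine intervalIntegral.norm_integral_le_of_norm_le_const fun r hr => ?_
  exact abs_integral_mul_le_of_weight hW hK hgK
    (uIcc_subset_Icc hs ht (uIoc_subset_uIcc hr))

theorem IsTest.continuousOn_pairing (h : IsTest φ) (hf : IsSolutionOn σ lam T f₀ f) :
    ContinuousOn (fun t => ∫ v, φ v * f t v) (Icc 0 T) := by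
  obtain ⟨C, hC, hW⟩ := hf.exists_weightBoundOn_one
  obtain ⟨K, hK⟩ := (h.isTest_adjointJ (σ := σ) (lam := lam)).exists_bound
  have nK := (abs_nonneg _).trans (hK 0)
  have : LipschitzOnWith (Real.toNNReal (K * C)) (fun t => ∫ v, φ v * f t v) (Icc 0 T) := by
    refine LipschitzOnWith.of_dist_le_mul fun t ht s hs => ?_
    rw [Real.coe_toNNReal _ (by positivity)]
    exact (h.weakPairOn hf).abs_sub_le hf hW nK (measurable_adjointJ h.1) (by simpa using hK) hs ht
  exact this.continuousOn

theorem WeakPairOn.hasDerivWithinAt {g : ℝ → ℝ} (h : WeakPairOn T f φ g)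
    (hc : ContinuousOn (fun t => ∫ v, g v * f t v) (Icc 0 T)) {t : ℝ} (ht : t ∈ Icc 0 T) :
    HasDerivWithinAt (fun t => ∫ v, φ v * f t v) (∫ v, g v * f t v) (Icc 0 T) t := by
  have h0 : (0 : ℝ) ∈ Icc 0 T := ⟨le_rfl, ht.1.trans ht.2⟩
  have hi : IntervalIntegrable (fun s => ∫ v, g v * f s v) volume 0 t :=
    (hc.mono (uIcc_subset_Icc h0 ht)).intervalIntegrable
  have : Fact (t ∈ Icc 0 T) := ⟨ht⟩
  have := (intervalIntegral.integral_hasDerivWithinAt_right hi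
    (s := Icc 0 T) (t := Icc 0 T)
    (hc.stronglyMeasurableAtFilter_nhdsWithin measurableSet_Icc t) (hc t ht)).const_add
      (∫ v, φ v * f 0 v)
  exact this.congr (fun s hs => h s hs) (h t ht)

/-! ### A maximum principle -/

theorem second_deriv_nonneg_of_isMin {g g' : ℝ → ℝ} {x g'' : ℝ} (h1 : ∀ y, HasDerivAt g (g' y) y)
    (h2 : HasDerivAt g' g'' x) (hx : ∀ y, g x ≤ g y) : 0 ≤ g'' := by
  by_contra! hneg
  have e1 : deriv g = g' := funext fun y => (h1 y).deriv
  have hmin : IsLocalMin g x := Eventually.of_forall hx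
  have hmax : IsLocalMax g x := isLocalMax_of_deriv_deriv_neg (by rw [e1, h2.deriv]; exact hneg)
    hmin.deriv_eq_zero (h1 x).continuousAt
  have hconst : g =ᶠ[𝓝 x] fun _ => g x := hmax.mono fun y hy => le_antisymm hy (hx y)
  have := hconst.deriv.deriv_eq
  rw [e1, h2.deriv] at this
  simp at this
  exact hneg.ne this

theorem deriv_nonpos_of_isMin_Icc {w : ℝ → ℝ} {t w' : ℝ} (ht : t ∈ Ioc 0 T)
    (hw : HasDerivWithinAt w w' (Icc 0 T) t) (hmin : ∀ s ∈ Icc 0 T, w t ≤ w s) : w' ≤ 0 := by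
  have hloc : IsLocalMinOn w (Icc 0 T) t := by
    filter_upwards [self_mem_nhdsWithin] with s hs using hmin s hs
  have htan : (0 : ℝ) - t ∈ posTangentConeAt (Icc 0 T) t := by
    refine sub_mem_posTangentConeAt_of_segment_subset ?_
    exact (convex_Icc 0 T).segment_subset ⟨ht.1.le, ht.2⟩ ⟨le_rfl, ht.1.le.trans ht.2⟩
  have := hloc.hasFDerivWithinAt_nonneg hw.hasFDerivWithinAt htan
  simp at this
  nlinarith [ht.1]

/-- The maximum principle for `∂ₜ u = κ (∂_y² u - ∂_y u) - λ ∂_y u + λ e^y ∂_B u` in the class of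
bounded functions. The barrier is a small multiple of
`e^(K t) (e^(2 y) + e^(-2 y) + B ^ 2 + 1)`. -/
theorem nonneg_of_pde {κ M : ℝ} (hκ : 0 ≤ κ) (hlam : 0 ≤ lam)
    {u uy uyy uB : ℝ → ℝ → ℝ → ℝ}
    (hcont : ∀ R, ContinuousOn (fun p : ℝ × ℝ × ℝ => u p.1 p.2.1 p.2.2)
      (Icc 0 T ×ˢ (Icc (-R) R ×ˢ Icc (-R) R)))
    (hbdd : ∀ t ∈ Icc 0 T, ∀ y B, |u t y B| ≤ M) (h0 : ∀ y B, 0 ≤ u 0 y B)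
    (hy : ∀ t ∈ Icc 0 T, ∀ y B, HasDerivAt (fun y => u t y B) (uy t y B) y)
    (hyy : ∀ t ∈ Icc 0 T, ∀ y B, HasDerivAt (fun y => uy t y B) (uyy t y B) y)
    (hB : ∀ t ∈ Icc 0 T, ∀ y B, HasDerivAt (fun B => u t y B) (uB t y B) B)
    (ht : ∀ t ∈ Icc 0 T, ∀ y B, HasDerivWithinAt (fun t => u t y B)
      (κ * (uyy t y B - uy t y B) - lam * uy t y B + lam * Real.exp y * uB t y B) (Icc 0 T) t)
    {t : ℝ} (htT : t ∈ Icc 0 T) (y B : ℝ) : 0 ≤ u t y B := by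
  by_contra! hneg
  -- The barrier is a strict supersolution for this rate of growth.
  set K := 4 * κ + 2 * (κ + lam) + lam + 1 with hK
  let wt : ℝ → ℝ → ℝ := fun y B => Real.exp (2 * y) + Real.exp (-(2 * y)) + B ^ 2 + 1
  have hwt1 : ∀ y B, 1 ≤ wt y B := fun y B => by
    have := Real.exp_pos (2 * y); have := Real.exp_pos (-(2 * y))
    simp only [wt]; nlinarith [sq_nonneg B]
  have hwty : ∀ y B, |y| ≤ wt y B := fun y B => by
    have e1 := Real.exp_pos (2 * y); have e2 := Real.exp_pos (-(2 * y))
    have e3 := Real.add_one_le_exp (2 * y); have e4 := Real.add_one_le_exp (-(2 * y))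
    simp only [wt]
    rcases abs_cases y with ⟨h, h'⟩ | ⟨h, h'⟩ <;> rw [h] <;> nlinarith [sq_nonneg B]
  have hwtB : ∀ y B, |B| ≤ wt y B := fun y B => by
    have e1 := Real.exp_pos (2 * y); have e2 := Real.exp_pos (-(2 * y))
    simp only [wt]
    nlinarith [sq_nonneg (|B| - 1), sq_abs B]
  obtain ⟨ε, hε, hεneg⟩ : ∃ ε > 0, u t y B + ε * Real.exp (K * t) * wt y B < 0 := by
    -- Half of the largest multiple of the barrier keeping the sum nonpositive at the given point.
    have hp : 0 < Real.exp (K * t) * wt y B := mul_pos (Real.exp_pos _) (one_pos.trans_le (hwt1 y B))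
    refine ⟨-u t y B / (2 * (Real.exp (K * t) * wt y B)), by
      exact div_pos (by linarith) (by linarith), ?_⟩
    have : -u t y B / (2 * (Real.exp (K * t) * wt y B)) * Real.exp (K * t) * wt y B
        = -u t y B / 2 := by
      have := (one_pos.trans_le (hwt1 y B)).ne'
      field_simp
    rw [this]; linarith
  let w : ℝ × ℝ × ℝ → ℝ := fun p =>
    u p.1 p.2.1 p.2.2 + ε * Real.exp (K * p.1) * wt p.2.1 p.2.2
  have hKpos : 0 < K := by positivity
  set R := max (M / ε) (max |y| |B|) with hR
  have hRy : y ∈ Icc (-R) R := abs_le.1 ((le_max_left _ _).trans (le_max_right _ _))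
  have hRB : B ∈ Icc (-R) R := abs_le.1 ((le_max_right _ _).trans (le_max_right _ _))
  obtain ⟨⟨t₀, y₀, B₀⟩, hp, hmin⟩ : ∃ p ∈ Icc 0 T ×ˢ (Icc (-R) R ×ˢ Icc (-R) R),
      IsMinOn w (Icc 0 T ×ˢ (Icc (-R) R ×ˢ Icc (-R) R)) p := by
    refine (isCompact_Icc.prod (isCompact_Icc.prod isCompact_Icc)).exists_isMinOn
      ⟨(t, y, B), htT, hRy, hRB⟩ ((hcont R).add ?_)
    exact Continuous.continuousOn (by fun_prop)
  obtain ⟨ht₀, hy₀, hB₀⟩ := hp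
  have hw0 : w (t₀, y₀, B₀) < 0 := (isMinOn_iff.1 hmin (t, y, B) ⟨htT, hRy, hRB⟩).trans_lt hεneg
  simp only at ht₀ hy₀ hB₀
  have hglob : ∀ t ∈ Icc 0 T, ∀ y B, w (t₀, y₀, B₀) ≤ w (t, y, B) := by
    intro t ht y B
    by_cases hin : y ∈ Icc (-R) R ∧ B ∈ Icc (-R) R
    · exact hmin ⟨ht, hin.1, hin.2⟩
    · have hRwt : R ≤ wt y B := by
        by_contra! hlt
        exact hin ⟨abs_le.1 ((hwty y B).trans hlt.le), abs_le.1 ((hwtB y B).trans hlt.le)⟩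
      have h1 : M / ε ≤ wt y B := (le_max_left _ _).trans hRwt
      have h2 : 1 ≤ Real.exp (K * t) := Real.one_le_exp (mul_nonneg hKpos.le ht.1)
      have h3 : M ≤ wt y B * ε := (div_le_iff₀ hε).1 h1
      have h4 := (abs_le.1 (hbdd t ht y B)).1
      have h5 : 0 ≤ w (t, y, B) := by
        simp only [w]
        nlinarith [mul_nonneg (mul_nonneg hε.le (zero_le_one.trans (hwt1 y B))) (sub_nonneg.2 h2)]
      exact hw0.le.trans h5
  have ht₀pos : t₀ ∈ Ioc 0 T := by
    refine ⟨lt_of_le_of_ne ht₀.1 fun h => ?_, ht₀.2⟩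
    have h1 := h0 y₀ B₀
    have h2 : 0 < ε * Real.exp (K * t₀) * wt y₀ B₀ :=
      mul_pos (mul_pos hε (Real.exp_pos _)) (one_pos.trans_le (hwt1 _ _))
    simp only [w, ← h] at hw0 h2
    linarith
  set E := ε * Real.exp (K * t₀) with hE
  have hEpos : 0 < E := mul_pos hε (Real.exp_pos _)
  -- The first and second order conditions in `y`, `B` and `t` at the minimum of `u` + barrier.
  have dwt : ∀ y, HasDerivAt (fun y => wt y B₀) (2 * Real.exp (2 * y) - 2 * Real.exp (-(2 * y))) y := by
    intro y
    have h1 : HasDerivAt (fun y : ℝ => 2 * y) 2 y := by simpa using (hasDerivAt_id y).const_mul 2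
    refine (((h1.exp.add h1.neg.exp).add_const (B₀ ^ 2)).add_const 1).congr_deriv ?_
    simp only [Pi.neg_apply]
    ring
  have ddwt : HasDerivAt (fun y => 2 * Real.exp (2 * y) - 2 * Real.exp (-(2 * y)))
      (4 * Real.exp (2 * y₀) + 4 * Real.exp (-(2 * y₀))) y₀ := by
    have h1 : HasDerivAt (fun y : ℝ => 2 * y) 2 y₀ := by
      simpa using (hasDerivAt_id y₀).const_mul 2
    refine ((h1.exp.const_mul 2).sub (h1.neg.exp.const_mul 2)).congr_deriv ?_
    simp only [Pi.neg_apply]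
    ring
  have dy : ∀ y, HasDerivAt (fun y => w (t₀, y, B₀))
      (uy t₀ y B₀ + E * (2 * Real.exp (2 * y) - 2 * Real.exp (-(2 * y)))) y := fun y =>
    (hy t₀ ht₀ y B₀).add ((dwt y).const_mul E)
  have ddy := (hyy t₀ ht₀ y₀ B₀).add (ddwt.const_mul E)
  have cy : uy t₀ y₀ B₀ + E * (2 * Real.exp (2 * y₀) - 2 * Real.exp (-(2 * y₀))) = 0 :=
    IsLocalMin.hasDerivAt_eq_zero (Eventually.of_forall fun y => hglob t₀ ht₀ y B₀) (dy y₀)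
  have cyy := second_deriv_nonneg_of_isMin dy ddy fun y => hglob t₀ ht₀ y B₀
  have dB : HasDerivAt (fun B => w (t₀, y₀, B)) (uB t₀ y₀ B₀ + E * (2 * B₀)) B₀ := by
    refine (hB t₀ ht₀ y₀ B₀).add ?_
    refine ((((hasDerivAt_pow 2 B₀).const_add
      (Real.exp (2 * y₀) + Real.exp (-(2 * y₀)))).add_const 1).const_mul E).congr_deriv ?_
    simp
  have cB : uB t₀ y₀ B₀ + E * (2 * B₀) = 0 :=
    IsLocalMin.hasDerivAt_eq_zero (Eventually.of_forall fun B => hglob t₀ ht₀ y₀ B) dB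
  have dt : HasDerivWithinAt (fun t => w (t, y₀, B₀))
      ((κ * (uyy t₀ y₀ B₀ - uy t₀ y₀ B₀) - lam * uy t₀ y₀ B₀
        + lam * Real.exp y₀ * uB t₀ y₀ B₀) + E * K * wt y₀ B₀) (Icc 0 T) t₀ := by
    refine (ht t₀ ht₀ y₀ B₀).add ?_
    have h1 : HasDerivAt (fun t : ℝ => K * t) K t₀ := by
      simpa using (hasDerivAt_id t₀).const_mul K
    refine ((h1.exp.const_mul ε).mul_const (wt y₀ B₀)).hasDerivWithinAt.congr_deriv ?_
    rw [hE]; ring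
  have ct := deriv_nonpos_of_isMin_Icc ht₀pos dt fun s hs => hglob s hs y₀ B₀
  have hp1 := Real.exp_pos (2 * y₀)
  have hp2 := Real.exp_pos (-(2 * y₀))
  have hpa : Real.exp (2 * y₀) = Real.exp y₀ ^ 2 := by
    rw [← Real.exp_nat_mul]; norm_num
  have e1 : uy t₀ y₀ B₀ = -(E * (2 * Real.exp (2 * y₀) - 2 * Real.exp (-(2 * y₀)))) := by linarith
  have e2 : uB t₀ y₀ B₀ = -(E * (2 * B₀)) := by linarith
  rw [e1, e2] at ct
  have e3 : κ * (-(E * (4 * Real.exp (2 * y₀) + 4 * Real.exp (-(2 * y₀))))) ≤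
      κ * uyy t₀ y₀ B₀ := mul_le_mul_of_nonneg_left (by linarith) hκ
  simp only [wt] at ct
  set p := Real.exp (2 * y₀)
  set q := Real.exp (-(2 * y₀))
  set a := Real.exp y₀
  have key : 0 < K * (p + q + B₀ ^ 2 + 1) - 4 * κ * (p + q) + 2 * (κ + lam) * (p - q)
      - 2 * lam * (a * B₀) := by
    have h1 : 2 * (a * B₀) ≤ p + B₀ ^ 2 := by rw [hpa]; nlinarith [sq_nonneg (a - B₀)]
    have h2 : lam * (2 * (a * B₀)) ≤ lam * (p + B₀ ^ 2) := mul_le_mul_of_nonneg_left h1 hlam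
    have h3 := sq_nonneg B₀
    rw [hK]
    nlinarith [mul_nonneg hκ hp1.le, mul_nonneg hκ hp2.le, mul_nonneg hlam hp1.le,
      mul_nonneg hlam hp2.le, mul_nonneg hκ h3, mul_nonneg hlam h3]
  nlinarith [mul_pos hEpos key]

/-! ### The pairing with affine images of a test function -/

theorem IsTest.integrable_affine {h : ℝ → ℝ} (hφ : IsTest φ) (hh : Integrable h) (a B : ℝ) :
    Integrable (fun v => φ (a * v + B) * h v) := by
  obtain ⟨K, hK⟩ := hφ.exists_bound
  refine hh.bdd_mul (c := K) ?_ (ae_of_all _ fun v => hK _)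
  exact (hφ.continuous.comp (by fun_prop)).aestronglyMeasurable

theorem IsTest.hasDerivAt_shift {h : ℝ → ℝ} (hφ : IsTest φ) (hh : Integrable h) (a B : ℝ) :
    HasDerivAt (fun B => ∫ v, φ (a * v + B) * h v) (∫ v, deriv φ (a * v + B) * h v) B := by
  obtain ⟨K, hK⟩ := hφ.isTest_deriv.exists_bound
  refine (hasDerivAt_integral_of_dominated_loc_of_deriv_le (bound := fun v => K * |h v|)
    (F' := fun B v => deriv φ (a * v + B) * h v) (x₀ := B)
    univ_mem (Eventually.of_forall fun B => (hφ.integrable_affine hh a B).aestronglyMeasurable)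
    (hφ.integrable_affine hh a B) (hφ.isTest_deriv.integrable_affine hh a B).aestronglyMeasurable
    (ae_of_all _ fun v B _ => ?_) (hh.abs.const_mul K) (ae_of_all _ fun v B _ => ?_)).2
  · rw [norm_mul]
    exact mul_le_mul_of_nonneg_right (hK _) (abs_nonneg _)
  · refine HasDerivAt.mul_const ?_ _
    have h1 : HasDerivAt (fun B => a * v + B) 1 B := (hasDerivAt_id B).const_add _
    exact ((hasDerivAt_of_smooth hφ.1 (a * v + B)).comp B h1).congr_deriv (mul_one _)

/-- Multiplication of a function by the variable. -/
def mulVar (φ : ℝ → ℝ) : ℝ → ℝ := fun x => x * φ x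

theorem IsTest.isTest_mulVar (hφ : IsTest φ) : IsTest (mulVar φ) :=
  hφ.smooth_mul (ψ := fun x => x) (by fun_prop)

/-- The derivative in the logarithm of the scale is again a combination of pairings with affine
images of test functions, since `e^y v = x - B` for `x = e^y v + B`. -/
theorem IsTest.hasDerivAt_scale {h : ℝ → ℝ} (hφ : IsTest φ) (hh : Integrable h) (y B : ℝ) :
    HasDerivAt (fun y => ∫ v, φ (Real.exp y * v + B) * h v)
      ((∫ v, mulVar (deriv φ) (Real.exp y * v + B) * h v)
        - B * ∫ v, deriv φ (Real.exp y * v + B) * h v) y := by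
  obtain ⟨K, hK⟩ := hφ.isTest_deriv.exists_bound
  obtain ⟨K', hK'⟩ := hφ.isTest_deriv.isTest_mulVar.exists_bound
  let F' : ℝ → ℝ → ℝ := fun y v => mulVar (deriv φ) (Real.exp y * v + B) * h v
    - B * (deriv φ (Real.exp y * v + B) * h v)
  have hint := (hφ.isTest_deriv.isTest_mulVar.integrable_affine hh (Real.exp y) B).sub
    ((hφ.isTest_deriv.integrable_affine hh (Real.exp y) B).const_mul B)
  have := (hasDerivAt_integral_of_dominated_loc_of_deriv_le (F' := F')
    (bound := fun v => (K' + |B| * K) * |h v|) (x₀ := y)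
    univ_mem (Eventually.of_forall fun y =>
      (hφ.integrable_affine hh (Real.exp y) B).aestronglyMeasurable)
    (hφ.integrable_affine hh (Real.exp y) B) hint.aestronglyMeasurable
    (ae_of_all _ fun v y _ => ?_) (hh.abs.const_mul _) (ae_of_all _ fun v y _ => ?_)).2
  · refine this.congr_deriv ?_
    rw [← integral_const_mul, ← integral_sub (hφ.isTest_deriv.isTest_mulVar.integrable_affine hh _ B)
      ((hφ.isTest_deriv.integrable_affine hh _ B).const_mul B)]
  · simp only [F']
    rw [← mul_assoc, ← sub_mul, norm_mul]
    refine mul_le_mul_of_nonneg_right ?_ (abs_nonneg _)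
    refine (abs_sub _ _).trans (add_le_add (hK' _) ?_)
    rw [abs_mul]
    exact mul_le_mul_of_nonneg_left (hK _) (abs_nonneg _)
  · have h1 : HasDerivAt (fun y => Real.exp y * v + B) (Real.exp y * v) y :=
      ((Real.hasDerivAt_exp y).mul_const v).add_const B
    refine (((hasDerivAt_of_smooth hφ.1 _).comp y h1).mul_const (h v)).congr_deriv ?_
    simp only [F', mulVar]
    ring

/-! ### Positivity -/

/-- An integrable function with nonnegative integrals against nonnegative test functions is
nonnegative almost everywhere. -/
theorem ae_nonneg_of_forall_isTest {h : ℝ → ℝ} (hh : Integrable h)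
    (hpos : ∀ φ, IsTest φ → (∀ v, 0 ≤ φ v) → 0 ≤ ∫ v, φ v * h v) : ∀ᵐ v, 0 ≤ h v := by
  let χ : ℕ → ContDiffBump (0 : ℝ) := fun n =>
    ⟨1 / ((n : ℝ) + 1), 2 * (1 / ((n : ℝ) + 1)), by positivity, by
      have : 0 < 1 / ((n : ℝ) + 1) := by positivity
      linarith⟩
  have hlim : Tendsto (fun n => (χ n).rOut) atTop (𝓝 0) := by
    simpa [χ] using (tendsto_one_div_add_atTop_nhds_zero_nat (𝕜 := ℝ)).const_mul 2
  filter_upwards [ContDiffBump.ae_convolution_tendsto_right_of_locallyIntegrable (μ := volume)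
    (K := 2) hlim (Eventually.of_forall fun n => le_rfl) hh.locallyIntegrable] with x hx
  refine ge_of_tendsto' hx fun n => ?_
  rw [convolution_eq_swap]
  have hsm : ContDiff ℝ ∞ ((χ n).normed volume) := (χ n).contDiff_normed
  have := hpos (fun v => (χ n).normed volume ((-1) * v + x))
    (IsTest.comp_affine (by norm_num) x ⟨hsm, (χ n).hasCompactSupport_normed⟩)
    fun v => (χ n).nonneg_normed _
  refine this.trans_eq (integral_congr_ae (ae_of_all _ fun v => ?_))
  simp [sub_eq_neg_add]

theorem adjointJ_affine (hφ : ContDiff ℝ ∞ φ) (a B v : ℝ) :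
    adjointJ σ lam (fun v => φ (a * v + B)) v =
      σ / 2 * (a * v) ^ 2 * deriv (deriv φ) (a * v + B)
        - lam * (a * v - a) * deriv φ (a * v + B) := by
  have d0 : ∀ v, HasDerivAt (fun v => a * v + B) a v := fun v => by
    simpa using ((hasDerivAt_id v).const_mul a).add_const B
  have d1 : ∀ v, HasDerivAt (fun v => φ (a * v + B)) (deriv φ (a * v + B) * a) v := fun v =>
    (hasDerivAt_of_smooth hφ _).comp v (d0 v)
  have d2 : ∀ v, HasDerivAt (fun v => deriv φ (a * v + B) * a)
      (deriv (deriv φ) (a * v + B) * a * a) v := fun v =>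
    ((hasDerivAt_of_smooth (contDiff_deriv hφ) _).comp v (d0 v)).mul_const a
  rw [adjointJ_eq d1 d2]
  ring

theorem deriv_mulVar (hφ : ContDiff ℝ ∞ φ) (x : ℝ) :
    deriv (mulVar φ) x = φ x + mulVar (deriv φ) x := by
  have := (hasDerivAt_id x).mul (hasDerivAt_of_smooth hφ x)
  have h2 := this.deriv
  simp only [id, one_mul] at h2
  exact h2

/-- The generator applied to `v ↦ φ (a v + B)` is bounded locally uniformly in the parameters. -/
theorem IsTest.abs_adjointJ_affine_le (hφ : IsTest φ) (R : ℝ) : ∃ K, ∀ a ∈ Icc 0 R,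
    ∀ B ∈ Icc (-R) R, ∀ v, |adjointJ σ lam (fun v => φ (a * v + B)) v| ≤ K := by
  obtain ⟨K₁, h₁⟩ := hφ.isTest_deriv.exists_bound
  obtain ⟨K₂, h₂⟩ := hφ.isTest_deriv.isTest_mulVar.exists_bound
  obtain ⟨K₃, h₃⟩ := hφ.isTest_deriv.isTest_deriv.exists_bound
  obtain ⟨K₄, h₄⟩ := hφ.isTest_deriv.isTest_deriv.isTest_mulVar.exists_bound
  obtain ⟨K₅, h₅⟩ := hφ.isTest_deriv.isTest_deriv.isTest_mulVar.isTest_mulVar.exists_bound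
  have n₁ := (abs_nonneg _).trans (h₁ 0)
  have n₃ := (abs_nonneg _).trans (h₃ 0)
  have n₄ := (abs_nonneg _).trans (h₄ 0)
  refine ⟨|σ / 2| * (K₅ + 2 * R * K₄ + R * R * K₃) + |lam| * (K₂ + (R + R) * K₁),
    fun a ha B hB v => ?_⟩
  have hB' : |B| ≤ R := abs_le.2 hB
  have ha' : |a| ≤ R := by rw [abs_of_nonneg ha.1]; exact ha.2
  have nR := (abs_nonneg _).trans hB'
  have nB := abs_nonneg B
  rw [adjointJ_affine hφ.1]
  set x := a * v + B with hx
  have e : σ / 2 * (a * v) ^ 2 * deriv (deriv φ) x - lam * (a * v - a) * deriv φ x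
      = σ / 2 * (mulVar (mulVar (deriv (deriv φ))) x - 2 * B * mulVar (deriv (deriv φ)) x
        + B * B * deriv (deriv φ) x) - lam * (mulVar (deriv φ) x - (B + a) * deriv φ x) := by
    have : a * v = x - B := by rw [hx]; ring
    rw [this]; simp only [mulVar]; ring
  rw [e]
  refine (abs_sub _ _).trans ?_
  rw [abs_mul, abs_mul lam]
  refine add_le_add (mul_le_mul_of_nonneg_left ?_ (abs_nonneg _))
    (mul_le_mul_of_nonneg_left ?_ (abs_nonneg _))
  · refine (abs_add_le _ _).trans (add_le_add ((abs_sub _ _).trans (add_le_add (h₅ x) ?_)) ?_)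
    · rw [abs_mul, abs_mul, abs_two]
      exact mul_le_mul (by linarith) (h₄ x) (abs_nonneg _) (by linarith)
    · rw [abs_mul, abs_mul]
      exact mul_le_mul (mul_le_mul hB' hB' nB nR) (h₃ x) (abs_nonneg _) (by positivity)
  · refine (abs_sub _ _).trans (add_le_add (h₂ x) ?_)
    rw [abs_mul]
    exact mul_le_mul ((abs_add_le _ _).trans (add_le_add hB' ha')) (h₁ x) (abs_nonneg _)
      (by positivity)

/-- Joint continuity of the pairing with affine images of a test function. -/
theorem IsTest.continuousOn_affine_pairing (hφ : IsTest φ) (hf : IsSolutionOn σ lam T f₀ f)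
    (R : ℝ) : ContinuousOn (fun p : ℝ × ℝ × ℝ => ∫ v, φ (Real.exp p.2.1 * v + p.2.2) * f p.1 v)
      (Icc 0 T ×ˢ (Icc (-R) R ×ˢ Icc (-R) R)) := by
  obtain ⟨C, hC, hW⟩ := hf.exists_weightBoundOn_one
  obtain ⟨K, hK⟩ := hφ.abs_adjointJ_affine_le (σ := σ) (lam := lam) (max R (Real.exp R))
  obtain ⟨M, hM⟩ := hφ.exists_bound
  refine continuousOn_prod_of_continuousOn_lipschitzOnWith _ (Real.toNNReal (max K 0 * C))
    (fun t ht => Continuous.continuousOn ?_) ?_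
  · have hint := hf.integrable ht
    refine continuous_of_dominated (bound := fun v => M * |f t v|)
      (fun q => (hφ.integrable_affine hint _ _).aestronglyMeasurable)
      (fun q => ae_of_all _ fun v => ?_) (hint.abs.const_mul M) (ae_of_all _ fun v => ?_)
    · rw [norm_mul]
      exact mul_le_mul_of_nonneg_right (hM _) (abs_nonneg _)
    · have := hφ.continuous
      change Continuous fun q : ℝ × ℝ => φ (Real.exp q.1 * v + q.2) * f t v
      fun_prop
  · rintro ⟨y, B⟩ ⟨hy, hB⟩
    refine LipschitzOnWith.of_dist_le_mul fun t ht s hs => ?_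
    rw [Real.coe_toNNReal _ (by positivity)]
    have htest := hφ.comp_affine (Real.exp_pos y).ne' B
    refine (htest.weakPairOn hf).abs_sub_le hf hW (le_max_right _ _) (measurable_adjointJ htest.1)
      (fun v => ?_) hs ht
    rw [mul_one]
    refine (hK _ ⟨(Real.exp_pos y).le, ?_⟩ B ⟨?_, ?_⟩ v).trans (le_max_left _ _)
    · exact (Real.exp_le_exp.2 hy.2).trans (le_max_right _ _)
    · exact (neg_le_neg (le_max_left _ _)).trans hB.1
    · exact hB.2.trans (le_max_left _ _)

/-- The solution with nonnegative initial value stays nonnegative. For a test function `φ ≥ 0`, the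
pairing of `f t` with `v ↦ φ (e^y v + B)` is a classical bounded solution, in the variables
`(t, y, B)`, of a degenerate parabolic equation, to which the maximum principle applies. -/
theorem IsSolutionOn.ae_nonneg (hf : IsSolutionOn σ lam T f₀ f) (hσ : 0 ≤ σ) (hlam : 0 ≤ lam)
    (h0 : ∀ᵐ v, 0 ≤ f 0 v) {t : ℝ} (ht : t ∈ Icc 0 T) : ∀ᵐ v, 0 ≤ f t v := by
  obtain ⟨C, hC, hW⟩ := hf.exists_weightBoundOn_one
  have hint : ∀ t ∈ Icc 0 T, Integrable (f t) := fun t ht => hf.integrable ht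
  refine ae_nonneg_of_forall_isTest (hint t ht) fun φ hφ hφ0 => ?_
  obtain ⟨M, hM⟩ := hφ.exists_bound
  have nM := (abs_nonneg _).trans (hM 0)
  have h1 := hφ.isTest_deriv
  have h2 := h1.isTest_mulVar
  have h3 := h2.isTest_deriv
  let P : (ℝ → ℝ) → ℝ → ℝ → ℝ → ℝ := fun ψ t y B => ∫ v, ψ (Real.exp y * v + B) * f t v
  let uy : ℝ → ℝ → ℝ → ℝ := fun t y B => P (mulVar (deriv φ)) t y B - B * P (deriv φ) t y B
  let uyy : ℝ → ℝ → ℝ → ℝ := fun t y B =>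
    (P (mulVar (deriv (mulVar (deriv φ)))) t y B - B * P (deriv (mulVar (deriv φ))) t y B)
      - B * (P (mulVar (deriv (deriv φ))) t y B - B * P (deriv (deriv φ)) t y B)
  have key : 0 ≤ P φ t 0 0 := by
    refine nonneg_of_pde (T := T) (κ := σ / 2) (lam := lam) (M := M * C) (u := P φ) (uy := uy)
      (uyy := uyy) (uB := P (deriv φ)) (by positivity) hlam
      (fun R => hφ.continuousOn_affine_pairing hf R) ?_ ?_ ?_ ?_ ?_ ?_ ht 0 0
    · intro t ht y B
      exact abs_integral_mul_le_of_weight (g := fun v => φ (Real.exp y * v + B)) hW nM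
        (fun v => by simpa using hM _) ht
    · intro y B
      refine integral_nonneg_of_ae ?_
      filter_upwards [h0] with v hv using mul_nonneg (hφ0 _) hv
    · exact fun t ht y B => hφ.hasDerivAt_scale (hint t ht) y B
    · exact fun t ht y B => (h2.hasDerivAt_scale (hint t ht) y B).sub
        ((h1.hasDerivAt_scale (hint t ht) y B).const_mul B)
    · exact fun t ht y B => hφ.hasDerivAt_shift (hint t ht) _ B
    · intro t ht y B
      have htest := hφ.comp_affine (Real.exp_pos y).ne' B
      refine ((htest.weakPairOn hf).hasDerivWithinAt (htest.isTest_adjointJ.continuousOn_pairing hf) ht).congr_deriv ?_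
      have i1 := h1.integrable_affine (hint t ht) (Real.exp y) B
      have i2 := h2.integrable_affine (hint t ht) (Real.exp y) B
      have i3 := h3.integrable_affine (hint t ht) (Real.exp y) B
      have i4 := h3.isTest_mulVar.integrable_affine (hint t ht) (Real.exp y) B
      have i5 := h1.isTest_deriv.integrable_affine (hint t ht) (Real.exp y) B
      have i6 := h1.isTest_deriv.isTest_mulVar.integrable_affine (hint t ht) (Real.exp y) B
      have e : ∀ v, adjointJ σ lam (fun v => φ (Real.exp y * v + B)) v * f t v =
          σ / 2 * (mulVar (deriv (mulVar (deriv φ))) (Real.exp y * v + B) * f t v)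
          - σ / 2 * B * (deriv (mulVar (deriv φ)) (Real.exp y * v + B) * f t v)
          - σ / 2 * B * (mulVar (deriv (deriv φ)) (Real.exp y * v + B) * f t v)
          + σ / 2 * B ^ 2 * (deriv (deriv φ) (Real.exp y * v + B) * f t v)
          - (σ / 2 + lam) * (mulVar (deriv φ) (Real.exp y * v + B) * f t v)
          + ((σ / 2 + lam) * B + lam * Real.exp y) * (deriv φ (Real.exp y * v + B) * f t v) := by
        intro v
        rw [adjointJ_affine hφ.1]
        set x := Real.exp y * v + B with hx
        have : Real.exp y * v = x - B := by rw [hx]; ring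
        have e' : mulVar (deriv (mulVar (deriv φ))) x
            = x * (deriv φ x + mulVar (deriv (deriv φ)) x) := by
          rw [← deriv_mulVar h1.1]; rfl
        rw [this, e', deriv_mulVar h1.1]
        simp only [mulVar]
        ring
      simp_rw [e]
      rw [integral_add, integral_sub, integral_add, integral_sub, integral_sub]
      · simp only [integral_const_mul]
        simp only [uy, uyy, P]
        ring
      all_goals fun_prop
  simpa [P] using key

/-! ### The smooth modulus -/

/-- The smooth approximation `√(v² + ε²)` of `|v|`. -/
noncomputable def smoothAbs (ε v : ℝ) : ℝ := √(v ^ 2 + ε ^ 2)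

section smoothAbs

variable {ε : ℝ}

theorem smoothAbs_sq (ε v : ℝ) : smoothAbs ε v ^ 2 = v ^ 2 + ε ^ 2 :=
  Real.sq_sqrt (by positivity)

theorem smoothAbs_pos (hε : 0 < ε) (v : ℝ) : 0 < smoothAbs ε v :=
  Real.sqrt_pos.2 (by positivity)

theorem abs_le_smoothAbs (ε v : ℝ) : |v| ≤ smoothAbs ε v :=
  Real.abs_le_sqrt (by nlinarith [sq_nonneg ε])

theorem le_smoothAbs (ε v : ℝ) : ε ≤ smoothAbs ε v :=
  Real.le_sqrt_of_sq_le (by nlinarith [sq_nonneg v])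

theorem smoothAbs_le (hε : 0 ≤ ε) (v : ℝ) : smoothAbs ε v ≤ |v| + ε :=
  Real.sqrt_le_iff.2 ⟨by positivity, by nlinarith [sq_abs v, mul_nonneg (abs_nonneg v) hε]⟩

theorem contDiff_smoothAbs (hε : 0 < ε) : ContDiff ℝ ∞ (smoothAbs ε) := by
  have : ContDiff ℝ ∞ fun v : ℝ => v ^ 2 + ε ^ 2 := by fun_prop
  exact this.sqrt fun v => by positivity

theorem hasDerivAt_smoothAbs (hε : 0 < ε) (v : ℝ) :
    HasDerivAt (smoothAbs ε) (v / smoothAbs ε v) v := by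
  have h1 : HasDerivAt (fun v : ℝ => v ^ 2 + ε ^ 2) (2 * v) v := by
    simpa using (hasDerivAt_pow 2 v).add_const (ε ^ 2)
  refine (h1.sqrt (by positivity)).congr_deriv ?_
  rw [smoothAbs, mul_div_mul_left _ _ two_ne_zero]

theorem hasDerivAt_div_smoothAbs (hε : 0 < ε) (v : ℝ) :
    HasDerivAt (fun v => v / smoothAbs ε v) (ε ^ 2 / smoothAbs ε v ^ 3) v := by
  have hp := smoothAbs_pos hε v
  refine ((hasDerivAt_id v).div (hasDerivAt_smoothAbs hε v) hp.ne').congr_deriv ?_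
  have := smoothAbs_sq ε v
  field_simp
  simp only [id]
  nlinarith

theorem abs_div_smoothAbs_le (ε v : ℝ) : |v / smoothAbs ε v| ≤ 1 := by
  rw [abs_div, abs_of_nonneg (show 0 ≤ smoothAbs ε v from Real.sqrt_nonneg _)]
  exact div_le_one_of_le₀ (abs_le_smoothAbs ε v) (Real.sqrt_nonneg _)

end smoothAbs

/-! ### Conservation of mass and propagation of the first moment -/

theorem IsSolutionOn.mass_eq (hf : IsSolutionOn σ lam T f₀ f) {t : ℝ} (ht : t ∈ Icc 0 T) :
    ∫ v, f t v = ∫ v, f 0 v := by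
  obtain ⟨C, hC, hW⟩ := hf.exists_weightBoundOn_one
  have := weakPairOn_of_weight (φ := fun _ => 1) (K := 1) hf hW contDiff_const zero_le_one
    (by simp) (by simp) (by simp) t ht
  simpa [adjointJ] using this

/-- Fatou's lemma for real integrals with a uniform upper bound. -/
theorem integrable_and_integral_le_of_tendsto {F : ℕ → ℝ → ℝ} {G : ℝ → ℝ} {D : ℝ}
    (hF : ∀ n, Integrable (F n)) (hF0 : ∀ n, ∀ᵐ v, 0 ≤ F n v) (hD : ∀ n, ∫ v, F n v ≤ D)
    (hG : ∀ᵐ v, Tendsto (fun n => F n v) atTop (𝓝 (G v))) : Integrable G ∧ ∫ v, G v ≤ D := by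
  have hD0 : 0 ≤ D := (integral_nonneg_of_ae (hF0 0)).trans (hD 0)
  have h1 : ∀ n, ∫⁻ v, ‖F n v‖ₑ ≤ ENNReal.ofReal D := fun n => by
    rw [← ofReal_integral_norm_eq_lintegral_enorm (hF n)]
    refine ENNReal.ofReal_le_ofReal (le_trans (le_of_eq ?_) (hD n))
    refine integral_congr_ae ?_
    filter_upwards [hF0 n] with v hv using Real.norm_of_nonneg hv
  have h2 : ∫⁻ v, ‖G v‖ₑ ≤ ENNReal.ofReal D := by
    refine (lintegral_enorm_le_liminf_of_tendsto hG
      (fun n => (hF n).aestronglyMeasurable.aemeasurable.enorm)).trans ?_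
    exact liminf_le_of_le (by isBoundedDefault) fun b hb => by
      obtain ⟨n, hn⟩ := hb.exists
      exact hn.trans (h1 n)
  have hGi : Integrable G := ⟨aestronglyMeasurable_of_tendsto_ae _
    (fun n => (hF n).aestronglyMeasurable) hG, h2.trans_lt ENNReal.ofReal_lt_top⟩
  refine ⟨hGi, (integral_mono hGi hGi.norm fun v => le_abs_self _).trans ?_⟩
  rw [← ofReal_integral_norm_eq_lintegral_enorm hGi] at h2
  exact (ENNReal.ofReal_le_ofReal_iff hD0).1 h2

/-- The bounded concave truncation `n g / (n + g)` of `g = √(1 + v²)`. -/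
noncomputable def truncAbs (n v : ℝ) : ℝ := n * smoothAbs 1 v / (n + smoothAbs 1 v)

section truncAbs

variable {n : ℝ}

theorem contDiff_truncAbs (hn : 0 < n) : ContDiff ℝ ∞ (truncAbs n) := by
  have h := contDiff_smoothAbs one_pos
  refine ContDiff.div (contDiff_const.mul h) (contDiff_const.add h) fun v => ?_
  have := smoothAbs_pos one_pos v
  positivity

theorem hasDerivAt_truncAbs (hn : 0 < n) (v : ℝ) : HasDerivAt (truncAbs n)
    (n ^ 2 * (v / smoothAbs 1 v) / (n + smoothAbs 1 v) ^ 2) v := by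
  have hp := smoothAbs_pos one_pos v
  have h := hasDerivAt_smoothAbs one_pos v
  refine ((h.const_mul n).div (h.const_add n) (by positivity)).congr_deriv ?_
  field_simp
  ring

theorem hasDerivAt_deriv_truncAbs (hn : 0 < n) (v : ℝ) :
    HasDerivAt (fun v => n ^ 2 * (v / smoothAbs 1 v) / (n + smoothAbs 1 v) ^ 2)
      (n ^ 2 * (1 / smoothAbs 1 v ^ 3) / (n + smoothAbs 1 v) ^ 2
        - 2 * n ^ 2 * (v / smoothAbs 1 v) ^ 2 / (n + smoothAbs 1 v) ^ 3) v := by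
  have hp := smoothAbs_pos one_pos v
  have h := hasDerivAt_smoothAbs one_pos v
  have h2 := hasDerivAt_div_smoothAbs one_pos v
  refine ((h2.const_mul (n ^ 2)).div ((h.const_add n).pow 2)
    (pow_pos (show 0 < n + smoothAbs 1 v by positivity) 2).ne').congr_deriv ?_
  simp only [Pi.pow_apply]
  field_simp
  norm_num
  ring

theorem truncAbs_nonneg (hn : 0 < n) (v : ℝ) : 0 ≤ truncAbs n v := by
  have hp := smoothAbs_pos one_pos v
  unfold truncAbs; positivity

theorem truncAbs_le (hn : 0 < n) (v : ℝ) : truncAbs n v ≤ smoothAbs 1 v := by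
  have hp := smoothAbs_pos one_pos v
  rw [truncAbs, div_le_iff₀ (by positivity)]
  nlinarith

theorem truncAbs_le_const (hn : 0 < n) (v : ℝ) : truncAbs n v ≤ n := by
  have hp := smoothAbs_pos one_pos v
  rw [truncAbs, div_le_iff₀ (by positivity)]
  nlinarith

theorem truncAbs_bounds (hn : 1 ≤ n) (v : ℝ) :
    (1 + |v|) * |deriv (truncAbs n) v| ≤ 3 * n ^ 2 ∧
      v ^ 2 * |deriv (deriv (truncAbs n)) v| ≤ 3 * n ^ 2 := by
  have hn0 : 0 < n := one_pos.trans_le hn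
  have e1 : deriv (truncAbs n) = fun v => n ^ 2 * (v / smoothAbs 1 v) / (n + smoothAbs 1 v) ^ 2 :=
    funext fun v => (hasDerivAt_truncAbs hn0 v).deriv
  rw [e1, (hasDerivAt_deriv_truncAbs hn0 v).deriv]
  have hp := smoothAbs_pos one_pos v
  have hv := abs_le_smoothAbs 1 v
  have h1 := le_smoothAbs 1 v
  have hq := abs_div_smoothAbs_le 1 v
  set g := smoothAbs 1 v
  have hvg : v ^ 2 ≤ g ^ 2 := by rw [← sq_abs]; gcongr
  constructor
  · simp only
    rw [abs_div, abs_mul, abs_of_pos (show 0 < n ^ 2 by positivity),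
      abs_of_pos (show 0 < (n + g) ^ 2 by positivity), mul_div_assoc', div_le_iff₀ (by positivity)]
    have h3 : n ^ 2 * |v / g| ≤ n ^ 2 := mul_le_of_le_one_right (by positivity) hq
    calc (1 + |v|) * (n ^ 2 * |v / g|) ≤ (g + g) * n ^ 2 := by gcongr
      _ ≤ 3 * n ^ 2 * (n + g) ^ 2 := by
        have : g + g ≤ 3 * (n + g) ^ 2 := by nlinarith
        nlinarith [sq_nonneg n]
  · have a1 : |n ^ 2 * (1 / g ^ 3) / (n + g) ^ 2| ≤ n ^ 2 / g ^ 2 := by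
      rw [abs_of_nonneg (by positivity), div_le_div_iff₀ (by positivity) (by positivity)]
      have : 1 / g ^ 3 ≤ 1 := div_le_one_of_le₀ (one_le_pow₀ h1) (by positivity)
      calc n ^ 2 * (1 / g ^ 3) * g ^ 2 ≤ n ^ 2 * 1 * (n + g) ^ 2 := by gcongr; linarith
        _ = n ^ 2 * (n + g) ^ 2 := by ring
    have a2 : |2 * n ^ 2 * (v / g) ^ 2 / (n + g) ^ 3| ≤ 2 * n ^ 2 / g ^ 2 := by
      rw [abs_of_nonneg (by positivity), div_le_div_iff₀ (by positivity) (by positivity)]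
      have h3 : (v / g) ^ 2 ≤ 1 := by rw [← sq_abs]; exact pow_le_one₀ (abs_nonneg _) hq
      have h4 : g ^ 2 ≤ (n + g) ^ 3 := by
        calc g ^ 2 ≤ (n + g) ^ 2 := by gcongr; linarith
          _ ≤ (n + g) ^ 3 := pow_le_pow_right₀ (by linarith) (by norm_num)
      calc 2 * n ^ 2 * (v / g) ^ 2 * g ^ 2 ≤ 2 * n ^ 2 * 1 * (n + g) ^ 3 := by gcongr
        _ = 2 * n ^ 2 * (n + g) ^ 3 := by ring
    calc _ ≤ v ^ 2 * (n ^ 2 / g ^ 2 + 2 * n ^ 2 / g ^ 2) := by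
          gcongr
          exact (abs_sub _ _).trans (add_le_add a1 a2)
      _ ≤ g ^ 2 * (n ^ 2 / g ^ 2 + 2 * n ^ 2 / g ^ 2) := by gcongr
      _ = 3 * n ^ 2 := by field_simp; norm_num

/-- Concavity of the truncation makes the generator bounded above independently of it. -/
theorem adjointJ_truncAbs_le (hσ : 0 ≤ σ) (hlam : 0 ≤ lam) (hn : 0 < n) (v : ℝ) :
    adjointJ σ lam (truncAbs n) v ≤ σ / 2 + lam := by
  rw [adjointJ_eq (hasDerivAt_truncAbs hn) (hasDerivAt_deriv_truncAbs hn)]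
  have hp := smoothAbs_pos one_pos v
  have hv := abs_le_smoothAbs 1 v
  have h1 := le_smoothAbs 1 v
  have hq := abs_div_smoothAbs_le 1 v
  set g := smoothAbs 1 v
  have hvg : v ^ 2 ≤ g ^ 2 := by rw [← sq_abs]; gcongr
  have b1 : v ^ 2 * (n ^ 2 * (1 / g ^ 3) / (n + g) ^ 2) ≤ 1 := by
    rw [mul_div_assoc', div_le_iff₀ (by positivity), one_mul]
    calc v ^ 2 * (n ^ 2 * (1 / g ^ 3)) ≤ g ^ 3 * (n ^ 2 * (1 / g ^ 3)) := by
          gcongr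
          exact hvg.trans (pow_le_pow_right₀ h1 (by norm_num))
      _ = n ^ 2 := by field_simp
      _ ≤ (n + g) ^ 2 := by gcongr; linarith
  have b2 : 0 ≤ v ^ 2 * (2 * n ^ 2 * (v / g) ^ 2 / (n + g) ^ 3) := by positivity
  have b3 : 0 ≤ v * (n ^ 2 * (v / g) / (n + g) ^ 2) := by
    have : v * (n ^ 2 * (v / g) / (n + g) ^ 2) = v ^ 2 * n ^ 2 / g / (n + g) ^ 2 := by
      field_simp
    rw [this]; positivity
  have b4 : n ^ 2 * (v / g) / (n + g) ^ 2 ≤ 1 := by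
    rw [div_le_one (by positivity)]
    calc n ^ 2 * (v / g) ≤ n ^ 2 * 1 := by gcongr; exact (le_abs_self _).trans hq
      _ ≤ (n + g) ^ 2 := by rw [mul_one]; gcongr; linarith
  nlinarith [mul_le_mul_of_nonneg_left b1 (show 0 ≤ σ / 2 by positivity),
    mul_nonneg (show 0 ≤ σ / 2 by positivity) b2, mul_nonneg hlam b3,
    mul_le_mul_of_nonneg_left b4 hlam]

theorem tendsto_truncAbs (v : ℝ) :
    Tendsto (fun k : ℕ => truncAbs ((k : ℝ) + 1) v) atTop (𝓝 (smoothAbs 1 v)) := by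
  have h : ∀ k : ℕ, truncAbs ((k : ℝ) + 1) v
      = smoothAbs 1 v / (1 + smoothAbs 1 v * (1 / ((k : ℝ) + 1))) := fun k => by
    have hp := smoothAbs_pos one_pos v
    rw [truncAbs]; field_simp
  simp_rw [h]
  have h2 : Tendsto (fun k : ℕ => smoothAbs 1 v / (1 + smoothAbs 1 v * (1 / ((k : ℝ) + 1)))) atTop
      (𝓝 (smoothAbs 1 v / (1 + smoothAbs 1 v * 0))) := (tendsto_const_nhds (x := smoothAbs 1 v)).div
    (((tendsto_one_div_add_atTop_nhds_zero_nat (𝕜 := ℝ)).const_mul (smoothAbs 1 v)).const_add 1)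
    (by simp)
  rwa [mul_zero, add_zero, div_one] at h2

end truncAbs

/-- The first absolute moment stays finite, uniformly on `[0, T]`: it is tested through the
truncations `truncAbs n`, whose images under the generator are bounded above uniformly in `n`. -/
theorem IsSolutionOn.exists_weightBoundOn_smoothAbs (hf : IsSolutionOn σ lam T f₀ f)
    (hσ : 0 ≤ σ) (hlam : 0 ≤ lam) (h0 : IsUnitMeanDensity (f 0)) :
    ∃ C, 0 ≤ C ∧ WeightBoundOn T f (smoothAbs 1) C := by
  obtain ⟨C, hC, hW⟩ := hf.exists_weightBoundOn_one
  have hg0 : Integrable (fun v => smoothAbs 1 v * f 0 v) := by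
    refine (h0.integrable_mul.abs.add h0.integrable.abs).mono
      ((contDiff_smoothAbs one_pos).continuous.aestronglyMeasurable.mul
        h0.integrable.aestronglyMeasurable) (ae_of_all _ fun v => ?_)
    have hp := smoothAbs_pos one_pos v
    rw [norm_mul, Real.norm_of_nonneg hp.le, Real.norm_eq_abs, Real.norm_eq_abs]
    refine le_trans ?_ (le_abs_self _)
    simp only [Pi.add_apply, abs_mul]
    rw [← add_one_mul]
    exact mul_le_mul_of_nonneg_right (smoothAbs_le zero_le_one v) (abs_nonneg _)
  set D := (∫ v, smoothAbs 1 v * f 0 v) + T * (σ / 2 + lam) with hD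
  have main : ∀ t ∈ Icc 0 T, Integrable (fun v => smoothAbs 1 v * |f t v|) ∧
      ∫ v, smoothAbs 1 v * |f t v| ≤ D := by
    intro t ht
    have hpos := fun s (hs : s ∈ Icc 0 T) => hf.ae_nonneg hσ hlam h0.nonneg hs
    have h0T : (0 : ℝ) ∈ Icc 0 T := ⟨le_rfl, ht.1.trans ht.2⟩
    have hnpos : ∀ n : ℕ, (0 : ℝ) < n + 1 := fun n => by positivity
    have hm : ∀ n : ℕ, Measurable (truncAbs ((n : ℝ) + 1)) := fun n =>
      (contDiff_truncAbs (hnpos n)).continuous.measurable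
    have hb : ∀ (n : ℕ) v, |truncAbs ((n : ℝ) + 1) v| ≤ ((n : ℝ) + 1) * 1 := fun n v => by
      rw [abs_of_nonneg (truncAbs_nonneg (hnpos n) v), mul_one]
      exact truncAbs_le_const (hnpos n) v
    refine integrable_and_integral_le_of_tendsto
      (F := fun n v => truncAbs ((n : ℝ) + 1) v * |f t v|) ?_ ?_ ?_ ?_
    · intro n
      have := (integrable_mul_of_weight hf hW (hm n) (hb n) ht).abs
      refine this.congr (ae_of_all _ fun v => ?_)
      simp only [abs_mul, abs_of_nonneg (truncAbs_nonneg (hnpos n) v)]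
    · exact fun n => ae_of_all _ fun v => mul_nonneg (truncAbs_nonneg (hnpos n) v) (abs_nonneg _)
    · intro n
      set m : ℝ := n + 1
      have hm1 : 1 ≤ m := by simp [m]
      have hm0 : 0 < m := hnpos n
      have hwp := weakPairOn_of_weight (φ := truncAbs m) (K := 3 * m ^ 2) hf hW
        (contDiff_truncAbs hm0) (by positivity)
        (fun v => (hb n v).trans (by nlinarith))
        (fun v => by simpa using (truncAbs_bounds hm1 v).1)
        (fun v => by simpa using (truncAbs_bounds hm1 v).2)
      have e : ∫ v, truncAbs m v * |f t v| = ∫ v, truncAbs m v * f t v := by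
        refine integral_congr_ae ?_
        filter_upwards [hpos t ht] with v hv
        rw [abs_of_nonneg hv]
      rw [e, hwp t ht, hD]
      have hJm : Measurable (adjointJ σ lam (truncAbs m)) :=
        measurable_adjointJ (contDiff_truncAbs hm0)
      have hJb := abs_adjointJ_le (σ := σ) (lam := lam) (φ := truncAbs m) (W := fun _ => 1)
        (K := 3 * m ^ 2)
        (fun v => by simpa using (truncAbs_bounds hm1 v).1)
        (fun v => by simpa using (truncAbs_bounds hm1 v).2)
      refine add_le_add ?_ ?_
      · refine integral_mono_ae (integrable_mul_of_weight hf hW (hm n) (hb n) h0T) hg0 ?_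
        filter_upwards [h0.nonneg] with v hv
          using mul_le_mul_of_nonneg_right (truncAbs_le hm0 v) hv
      · have hs : ∀ s ∈ Icc 0 t, ∫ v, adjointJ σ lam (truncAbs m) v * f s v ≤ σ / 2 + lam := by
          intro s hs
          have hs' : s ∈ Icc 0 T := ⟨hs.1, hs.2.trans ht.2⟩
          calc ∫ v, adjointJ σ lam (truncAbs m) v * f s v ≤ ∫ v, (σ / 2 + lam) * f s v := by
                refine integral_mono_ae (integrable_mul_of_weight hf hW hJm hJb hs')
                  ((hf.integrable hs').const_mul _) ?_
                filter_upwards [hpos s hs'] with v hv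
                  using mul_le_mul_of_nonneg_right (adjointJ_truncAbs_le hσ hlam hm0 v) hv
            _ = σ / 2 + lam := by
                rw [integral_const_mul, hf.mass_eq hs', h0.mass, mul_one]
        calc ∫ s in 0..t, ∫ v, adjointJ σ lam (truncAbs m) v * f s v
            ≤ ∫ _ in 0..t, (σ / 2 + lam) := intervalIntegral.integral_mono_on ht.1
              (intervalIntegrable_pairing hf hW (by positivity) hJm hJb h0T ht)
              (by simp) hs
          _ = t * (σ / 2 + lam) := by
            rw [intervalIntegral.integral_const, sub_zero, smul_eq_mul]
          _ ≤ T * (σ / 2 + lam) := mul_le_mul_of_nonneg_right ht.2 (by positivity)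
    · exact ae_of_all _ fun v => (tendsto_truncAbs v).mul_const _
  exact ⟨max D 0, le_max_right _ _, fun t ht => ⟨(main t ht).1, (main t ht).2.trans (le_max_left _ _)⟩⟩

/-- Mass is conserved, and so is the mean: `t ↦ ∫ (v - 1) f t` solves a homogeneous linear equation. -/
theorem IsSolutionOn.isUnitMeanDensity (hf : IsSolutionOn σ lam T f₀ f)
    (hσ : 0 ≤ σ) (hlam : 0 ≤ lam) (h0 : IsUnitMeanDensity (f 0)) {t : ℝ} (ht : t ∈ Icc 0 T) :
    IsUnitMeanDensity (f t) := by
  obtain ⟨C, hC, hW⟩ := hf.exists_weightBoundOn_smoothAbs hσ hlam h0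
  have hint : ∀ s ∈ Icc 0 T, Integrable (fun v => v * f s v) := fun s hs =>
    integrable_mul_of_weight hf hW (K := 1) measurable_id
      (fun v => by simpa using abs_le_smoothAbs 1 v) hs
  have d1 : ∀ v : ℝ, HasDerivAt (fun v : ℝ => v - 1) 1 v := fun v => (hasDerivAt_id v).sub_const 1
  have e1 : deriv (fun v : ℝ => v - 1) = fun _ => 1 := funext fun v => (d1 v).deriv
  have hb1 : ∀ v, (1 + |v|) * |deriv (fun v : ℝ => v - 1) v| ≤ 2 * smoothAbs 1 v := fun v => by
    rw [e1, abs_one, mul_one]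
    linarith [abs_le_smoothAbs 1 v, le_smoothAbs 1 v]
  have hb2 : ∀ v : ℝ, v ^ 2 * |deriv (deriv (fun v : ℝ => v - 1)) v| ≤ 2 * smoothAbs 1 v :=
    fun v => by
      rw [e1]
      simpa using (smoothAbs_pos one_pos v).le
  have hwp := weakPairOn_of_weight (φ := fun v => v - 1) (K := 2) hf hW (by fun_prop) (by norm_num)
    (fun v => by
      have := abs_sub v 1
      rw [abs_one] at this
      linarith [abs_le_smoothAbs 1 v, le_smoothAbs 1 v]) hb1 hb2
  have hJ : ∀ v, adjointJ σ lam (fun v => v - 1) v = -lam * (v - 1) := fun v => by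
    rw [adjointJ_eq d1 (fun v => hasDerivAt_const v 1)]; ring
  have hJm : Measurable (adjointJ σ lam (fun v => v - 1)) := measurable_adjointJ (by fun_prop)
  have hJb := abs_adjointJ_le (σ := σ) (lam := lam) hb1 hb2
  have hpair : ∀ s, ∫ v, adjointJ σ lam (fun v => v - 1) v * f s v
      = -lam * ∫ v, (v - 1) * f s v := fun s => by
    simp_rw [hJ, mul_assoc, integral_const_mul]
  have hcont : ContinuousOn (fun s => ∫ v, (v - 1) * f s v) (Icc 0 T) := by
    refine (LipschitzOnWith.of_dist_le_mul
      (K := Real.toNNReal ((|σ / 2| + |lam|) * 2 * C)) fun t ht s hs => ?_).continuousOn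
    rw [Real.coe_toNNReal _ (by positivity)]
    exact hwp.abs_sub_le hf hW (by positivity) hJm hJb hs ht
  have hzero : ∀ s ∈ Icc 0 T, ∫ v, (v - 1) * f s v = 0 := by
    refine eq_zero_of_abs_deriv_le_mul_abs_self_of_eq_zero_right (K := |lam|) hcont
      (f' := fun s => -lam * ∫ v, (v - 1) * f s v) (fun s hs => ?_) ?_ fun s hs => ?_
    · have h := hwp.hasDerivWithinAt (by simpa only [hpair] using hcont.const_mul (-lam))
        (Ico_subset_Icc_self hs)
      rw [hpair] at h
      exact h.mono_of_mem_nhdsWithin (Icc_mem_nhdsGE_of_mem hs)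
    · simp_rw [sub_mul, one_mul]
      rw [integral_sub h0.integrable_mul h0.integrable, h0.mean, h0.mass, sub_self]
    · rw [norm_mul, norm_neg, Real.norm_eq_abs]
  have hmass : ∫ v, f t v = 1 := (hf.mass_eq ht).trans h0.mass
  refine ⟨hf.ae_nonneg hσ hlam h0.nonneg ht, hf.integrable ht, hmass, hint t ht, ?_⟩
  have := hzero t ht
  simp_rw [sub_mul, one_mul] at this
  rw [integral_sub (hint t ht) (hf.integrable ht), hmass] at this
  linarith

/-! ### Smooth steps -/

/-- A smooth step of width `δ`, vanishing left of `c` and equal to `1` right of `c + δ`. -/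
noncomputable def stepAt (δ c v : ℝ) : ℝ := Real.smoothTransition (δ⁻¹ * v + -(δ⁻¹ * c))

/-- The first derivative of the profile of `stepAt δ c`, in the rescaled variable. -/
noncomputable def stepDeriv (δ c v : ℝ) : ℝ := deriv Real.smoothTransition (δ⁻¹ * v + -(δ⁻¹ * c))

theorem deriv_smoothTransition_eq_zero {x : ℝ} (hx : x ∉ Icc (0 : ℝ) 1) :
    deriv Real.smoothTransition x = 0 := by
  rcases lt_or_ge x 0 with h | h
  · have : Real.smoothTransition =ᶠ[𝓝 x] fun _ => 0 := by
      filter_upwards [Iio_mem_nhds h] with y hy using Real.smoothTransition.zero_of_nonpos hy.le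
    simpa using this.deriv_eq
  · have h1 : 1 < x := by by_contra! h'; exact hx ⟨h, h'⟩
    have : Real.smoothTransition =ᶠ[𝓝 x] fun _ => 1 := by
      filter_upwards [Ioi_mem_nhds h1] with y hy using Real.smoothTransition.one_of_one_le hy.le
    simpa using this.deriv_eq

theorem deriv_deriv_smoothTransition_eq_zero {x : ℝ} (hx : x ∉ Icc (0 : ℝ) 1) :
    deriv (deriv Real.smoothTransition) x = 0 := by
  have : deriv Real.smoothTransition =ᶠ[𝓝 x] fun _ => 0 := by
    filter_upwards [isClosed_Icc.isOpen_compl.mem_nhds hx] with y hy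
      using deriv_smoothTransition_eq_zero hy
  simpa using this.deriv_eq

theorem isTest_deriv_smoothTransition : IsTest (deriv Real.smoothTransition) :=
  ⟨contDiff_deriv Real.smoothTransition.contDiff,
    HasCompactSupport.intro isCompact_Icc fun _ hx => deriv_smoothTransition_eq_zero hx⟩

theorem exists_bound_deriv_smoothTransition : ∃ K, 0 ≤ K ∧
    (∀ x, |deriv Real.smoothTransition x| ≤ K) ∧
    ∀ x, |deriv (deriv Real.smoothTransition) x| ≤ K := by
  obtain ⟨K₁, h₁⟩ := isTest_deriv_smoothTransition.exists_bound
  obtain ⟨K₂, h₂⟩ := isTest_deriv_smoothTransition.isTest_deriv.exists_bound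
  exact ⟨max K₁ K₂, (abs_nonneg _).trans ((h₁ 0).trans (le_max_left _ _)),
    fun x => (h₁ x).trans (le_max_left _ _), fun x => (h₂ x).trans (le_max_right _ _)⟩

theorem deriv_smoothTransition_nonneg (x : ℝ) : 0 ≤ deriv Real.smoothTransition x :=
  Real.smoothTransition.monotone.deriv_nonneg

theorem abs_stepAt_le (δ c v : ℝ) : |stepAt δ c v| ≤ 1 := by
  rw [stepAt, abs_of_nonneg (Real.smoothTransition.nonneg _)]
  exact Real.smoothTransition.le_one _

theorem contDiff_stepAt (δ c : ℝ) : ContDiff ℝ ∞ (stepAt δ c) :=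
  Real.smoothTransition.contDiff.comp (by fun_prop)

theorem isTest_stepDeriv {δ : ℝ} (hδ : 0 < δ) (c : ℝ) : IsTest (stepDeriv δ c) :=
  isTest_deriv_smoothTransition.comp_affine (inv_pos.2 hδ).ne' _

theorem mem_Icc_of_rescaled_mem {δ c v : ℝ} (hδ : 0 < δ)
    (h : δ⁻¹ * v + -(δ⁻¹ * c) ∈ Icc (0 : ℝ) 1) : v ∈ Icc c (c + δ) := by
  have e : δ⁻¹ * v + -(δ⁻¹ * c) = (v - c) / δ := by field_simp; ring
  rw [e] at h
  have h1 := (le_div_iff₀ hδ).1 h.1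
  have h2 := (div_le_iff₀ hδ).1 h.2
  constructor <;> linarith

theorem hasCompactSupport_deriv_stepAt {δ : ℝ} (hδ : 0 < δ) (c : ℝ) :
    HasCompactSupport (deriv (stepAt δ c)) := by
  have e : deriv (stepAt δ c) = fun v => δ⁻¹ * stepDeriv δ c v := by
    funext v
    have d0 : HasDerivAt (fun v => δ⁻¹ * v + -(δ⁻¹ * c)) δ⁻¹ v := by
      simpa using ((hasDerivAt_id v).const_mul δ⁻¹).add_const (-(δ⁻¹ * c))
    have := (hasDerivAt_of_smooth Real.smoothTransition.contDiff (δ⁻¹ * v + -(δ⁻¹ * c))).comp v d0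
    exact this.deriv.trans (mul_comm _ _)
  rw [e]
  exact (isTest_stepDeriv hδ c).2.mul_left

theorem isTest_adjointJ_stepAt {δ : ℝ} (hδ : 0 < δ) (c : ℝ) :
    IsTest (adjointJ σ lam (stepAt δ c)) :=
  isTest_adjointJ_of_deriv (contDiff_stepAt δ c) (hasCompactSupport_deriv_stepAt hδ c)

/-- The weak equation for functions which are constant near `-∞` and near `+∞`. -/
theorem weakPairOn_of_deriv (hf : IsSolutionOn σ lam T f₀ f) {M : ℝ} (hφ : ContDiff ℝ ∞ φ)
    (hM : ∀ v, |φ v| ≤ M) (hc : HasCompactSupport (deriv φ)) :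
    WeakPairOn T f φ (adjointJ σ lam φ) := by
  obtain ⟨C, hC, hW⟩ := hf.exists_weightBoundOn_one
  have c1 := (contDiff_deriv hφ).continuous
  have c2 := (contDiff_deriv (contDiff_deriv hφ)).continuous
  obtain ⟨K₁, h₁⟩ := (hc.mul_left (f := fun v => 1 + |v|)).exists_bound_of_continuous (by fun_prop)
  obtain ⟨K₂, h₂⟩ := (hc.deriv.mul_left (f := fun v => v ^ 2)).exists_bound_of_continuous
    (by fun_prop)
  refine weakPairOn_of_weight hf hW hφ (K := max M (max K₁ K₂))
    ((abs_nonneg _).trans ((hM 0).trans (le_max_left _ _))) (fun v => ?_) (fun v => ?_) fun v => ?_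
  · rw [mul_one]; exact (hM v).trans (le_max_left _ _)
  · have : ‖(1 + |v|) * deriv φ v‖ ≤ K₁ := h₁ v
    rw [Real.norm_eq_abs, abs_mul, abs_of_pos (by positivity : 0 < 1 + |v|)] at this
    rw [mul_one]; exact this.trans ((le_max_left _ _).trans (le_max_right _ _))
  · have : ‖v ^ 2 * deriv (deriv φ) v‖ ≤ K₂ := h₂ v
    rw [Real.norm_eq_abs, abs_mul, abs_of_nonneg (sq_nonneg v)] at this
    rw [mul_one]; exact this.trans ((le_max_right _ _).trans (le_max_right _ _))

theorem weakPairOn_stepAt (hf : IsSolutionOn σ lam T f₀ f) {δ : ℝ} (hδ : 0 < δ) (c : ℝ) :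
    WeakPairOn T f (stepAt δ c) (adjointJ σ lam (stepAt δ c)) :=
  weakPairOn_of_deriv hf (contDiff_stepAt δ c) (abs_stepAt_le δ c)
    (hasCompactSupport_deriv_stepAt hδ c)

theorem abs_integral_mul_le_of_support {g h : ℝ → ℝ} {C M c δ : ℝ} (hδ : 0 ≤ δ) (hM : 0 ≤ M)
    (hg : ∀ v, |g v| ≤ M) (hsupp : ∀ v, v ∉ Icc c (c + δ) → g v = 0) (hh : ∀ᵐ v, |h v| ≤ C) :
    |∫ v, g v * h v| ≤ M * C * δ := by
  have hi : Integrable ((Icc c (c + δ)).indicator fun _ => M * C) :=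
    (integrable_indicator_iff measurableSet_Icc).2 continuous_const.integrableOn_Icc
  have := norm_integral_le_of_norm_le (f := fun v => g v * h v) hi ?_
  · rw [integral_indicator measurableSet_Icc] at this
    simp only [setIntegral_const, smul_eq_mul, Real.volume_real_Icc, add_sub_cancel_left,
      max_eq_left hδ] at this
    rw [← Real.norm_eq_abs]; linarith
  · filter_upwards [hh] with v hv
    by_cases hin : v ∈ Icc c (c + δ)
    · rw [indicator_of_mem hin, norm_mul]
      exact mul_le_mul (hg v) hv (abs_nonneg _) hM
    · rw [indicator_of_notMem hin, hsupp v hin, zero_mul, norm_zero]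

/-- Near the step the generator acts as the transport operator with speed `lam`: the diffusion and
the variation of the drift are small there, because they vanish at `v = 0`. -/
theorem abs_adjointJ_stepAt_sub_le {h : ℝ → ℝ} {δ c ρ C K : ℝ} (hσ : 0 ≤ σ) (hlam : 0 ≤ lam)
    (hδ : 0 < δ) (hc : |c| ≤ ρ) (hi : Integrable h) (hh : ∀ᵐ v, |h v| ≤ C) (hK : 0 ≤ K)
    (hK₁ : ∀ x, |deriv Real.smoothTransition x| ≤ K)
    (hK₂ : ∀ x, |deriv (deriv Real.smoothTransition) x| ≤ K) :
    |(∫ v, adjointJ σ lam (stepAt δ c) v * h v) - lam * δ⁻¹ * ∫ v, stepDeriv δ c v * h v|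
      ≤ (σ / 2 * (δ⁻¹ * ρ + 1) ^ 2 * K + lam * (δ⁻¹ * ρ + 1) * K) * C * δ := by
  have hρ : 0 ≤ ρ := (abs_nonneg _).trans hc
  have hδ' : 0 < δ⁻¹ := inv_pos.2 hδ
  have i1 : Integrable fun v => adjointJ σ lam (stepAt δ c) v * h v := by
    simpa using (isTest_adjointJ_stepAt (σ := σ) (lam := lam) hδ c).integrable_affine hi 1 0
  have i2 : Integrable fun v => stepDeriv δ c v * h v := by
    simpa using (isTest_stepDeriv hδ c).integrable_affine hi 1 0
  rw [← integral_const_mul, ← integral_sub i1 (i2.const_mul _)]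
  simp_rw [← mul_assoc, ← sub_mul]
  have e : ∀ v, adjointJ σ lam (stepAt δ c) v - lam * δ⁻¹ * stepDeriv δ c v =
      σ / 2 * (δ⁻¹ * v) ^ 2 * deriv (deriv Real.smoothTransition) (δ⁻¹ * v + -(δ⁻¹ * c))
      - lam * (δ⁻¹ * v) * deriv Real.smoothTransition (δ⁻¹ * v + -(δ⁻¹ * c)) := fun v => by
    have := adjointJ_affine (σ := σ) (lam := lam) Real.smoothTransition.contDiff δ⁻¹
      (-(δ⁻¹ * c)) v
    change adjointJ σ lam (stepAt δ c) v = _ at this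
    rw [this, stepDeriv]; ring
  simp_rw [e]
  refine abs_integral_mul_le_of_support (c := c) hδ.le (by positivity) (fun v => ?_)
    (fun v hv => ?_) hh
  · by_cases hx : δ⁻¹ * v + -(δ⁻¹ * c) ∈ Icc (0 : ℝ) 1
    · have hv : |δ⁻¹ * v| ≤ δ⁻¹ * ρ + 1 := by
        have h1 : δ⁻¹ * v = δ⁻¹ * c + (δ⁻¹ * v + -(δ⁻¹ * c)) := by ring
        rw [h1]
        refine (abs_add_le _ _).trans (add_le_add ?_ ?_)
        · rw [abs_mul, abs_of_pos hδ']
          exact mul_le_mul_of_nonneg_left hc hδ'.le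
        · rw [abs_of_nonneg hx.1]; exact hx.2
      refine (abs_sub _ _).trans ?_
      rw [abs_mul, abs_mul, abs_mul, abs_mul, abs_of_nonneg hlam,
        abs_of_nonneg (by positivity : 0 ≤ σ / 2), abs_pow]
      gcongr
      · exact hK₂ _
      · exact hK₁ _
    · rw [deriv_smoothTransition_eq_zero hx, deriv_deriv_smoothTransition_eq_zero hx]
      simp only [mul_zero, sub_zero, abs_zero]
      positivity
  · have hx := mt (mem_Icc_of_rescaled_mem hδ) hv
    rw [deriv_smoothTransition_eq_zero hx, deriv_deriv_smoothTransition_eq_zero hx]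
    simp

theorem abs_integral_stepAt_sub_le {h : ℝ → ℝ} {δ c C : ℝ} (hδ : 0 < δ) (hi : Integrable h)
    (hh : ∀ᵐ v, |h v| ≤ C) :
    |(∫ v, stepAt δ c v * h v) - ∫ v in Ioi c, h v| ≤ C * δ := by
  have i1 : Integrable fun v => stepAt δ c v * h v :=
    hi.bdd_mul (c := 1) (contDiff_stepAt δ c).continuous.aestronglyMeasurable
      (ae_of_all _ fun v => abs_stepAt_le δ c v)
  have e : ∫ v in Ioi c, h v = ∫ v, (Ioi c).indicator (fun _ => 1) v * h v := by
    rw [← integral_indicator measurableSet_Ioi]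
    refine integral_congr_ae (ae_of_all _ fun v => ?_)
    by_cases hv : v ∈ Ioi c <;> simp [hv]
  have i2 : Integrable fun v => (Ioi c).indicator (fun _ => (1 : ℝ)) v * h v := by
    refine (hi.indicator (measurableSet_Ioi (a := c))).congr (ae_of_all _ fun v => ?_)
    by_cases hv : v ∈ Ioi c <;> simp [hv]
  rw [e, ← integral_sub i1 i2]
  simp_rw [← sub_mul]
  have hval : ∀ v, v ∉ Icc c (c + δ) → stepAt δ c v - (Ioi c).indicator (fun _ => 1) v = 0 := by
    intro v hv
    have e' : δ⁻¹ * v + -(δ⁻¹ * c) = (v - c) / δ := by field_simp; ring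
    rcases lt_or_ge v c with h1 | h1
    · rw [stepAt, e', Real.smoothTransition.zero_of_nonpos
        (div_nonpos_of_nonpos_of_nonneg (by linarith) hδ.le)]
      simp [h1.le]
    · have h2 : c + δ < v := by by_contra! h'; exact hv ⟨h1, h'⟩
      rw [stepAt, e', Real.smoothTransition.one_of_one_le
        ((one_le_div hδ).2 (by linarith))]
      simp [show c < v by linarith]
  have := abs_integral_mul_le_of_support (M := 1) hδ.le zero_le_one (fun v => ?_) hval hh
  · simpa using this
  · have h1 : 0 ≤ stepAt δ c v := Real.smoothTransition.nonneg _
    have h2 : stepAt δ c v ≤ 1 := Real.smoothTransition.le_one _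
    by_cases hv : v ∈ Ioi c
    · rw [indicator_of_mem hv, abs_le]; constructor <;> linarith
    · rw [indicator_of_notMem hv, abs_le]; constructor <;> linarith

theorem le_of_forall_pos_le_add_mul {x y Q : ℝ} (hQ : 0 ≤ Q) (h : ∀ δ > 0, x ≤ y + δ * Q) :
    x ≤ y := by
  refine le_of_forall_pos_le_add fun ε hε => (h (ε / (Q + 1)) (by positivity)).trans ?_
  have : ε / (Q + 1) * Q ≤ ε := by
    rw [div_mul_eq_mul_div, div_le_iff₀ (by positivity)]
    nlinarith
  linarith

/-- The mass on the positive half-line is nondecreasing and Lipschitz in time. -/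
theorem IsSolutionOn.massPos_sub_mem (hf : IsSolutionOn σ lam T f₀ f) (hσ : 0 ≤ σ)
    (hlam : 0 ≤ lam) (hpos : ∀ t ∈ Icc 0 T, ∀ᵐ v, 0 ≤ f t v) : ∃ L, 0 ≤ L ∧
    ∀ s ∈ Icc 0 T, ∀ t ∈ Icc 0 T, s ≤ t →
      massPos (f t) - massPos (f s) ∈ Icc 0 (L * (t - s)) := by
  obtain ⟨C', hC'⟩ := hf.bounded
  obtain ⟨C₁, hC₁, hW⟩ := hf.exists_weightBoundOn_one
  obtain ⟨K, hK, hK₁, hK₂⟩ := exists_bound_deriv_smoothTransition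
  set C := max C' 0
  have hC : 0 ≤ C := le_max_right _ _
  have hbd : ∀ t ∈ Icc 0 T, ∀ᵐ v, |f t v| ≤ C := fun t ht => by
    filter_upwards [(hC' t ht).2.2] with v hv using hv.trans (le_max_left _ _)
  refine ⟨lam * K * C, by positivity, fun s hs t ht hst => ?_⟩
  set M := σ / 2 * K + lam * K
  have hM : 0 ≤ M := by positivity
  have hts : 0 ≤ t - s := sub_nonneg.2 hst
  have hstep : ∀ δ > 0, ∀ t ∈ Icc 0 T,
      |(∫ v, stepAt δ 0 v * f t v) - massPos (f t)| ≤ C * δ := fun δ hδ t ht =>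
    abs_integral_stepAt_sub_le hδ (hf.integrable ht) (hbd t ht)
  -- At the origin the drift points to the right, so the transport term has a sign.
  have hgen : ∀ δ > 0, ∀ r ∈ Icc 0 T, ∫ v, adjointJ σ lam (stepAt δ 0) v * f r v ∈
      Icc (-(M * C * δ)) (lam * K * C + M * C * δ) := by
    intro δ hδ r hr
    have h1 := abs_adjointJ_stepAt_sub_le (σ := σ) (lam := lam) (c := 0) (ρ := 0) hσ hlam hδ
      (by simp) (hf.integrable hr) (hbd r hr) hK hK₁ hK₂
    simp only [mul_zero, zero_add, one_pow, mul_one] at h1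
    have h2 : 0 ≤ ∫ v, stepDeriv δ 0 v * f r v := by
      refine integral_nonneg_of_ae ?_
      filter_upwards [hpos r hr] with v hv
        using mul_nonneg (deriv_smoothTransition_nonneg _) hv
    have h3 : |∫ v, stepDeriv δ 0 v * f r v| ≤ K * C * δ :=
      abs_integral_mul_le_of_support (c := 0) hδ.le hK (fun v => hK₁ _)
        (fun v hv => deriv_smoothTransition_eq_zero (mt (mem_Icc_of_rescaled_mem hδ) hv)) (hbd r hr)
    have h4 : 0 ≤ lam * δ⁻¹ * ∫ v, stepDeriv δ 0 v * f r v := by positivity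
    have h5 : lam * δ⁻¹ * ∫ v, stepDeriv δ 0 v * f r v ≤ lam * K * C := by
      calc _ ≤ lam * δ⁻¹ * (K * C * δ) :=
            mul_le_mul_of_nonneg_left ((le_abs_self _).trans h3) (by positivity)
        _ = lam * K * C := by field_simp
    change _ ≤ M * C * δ at h1
    have h6 := abs_le.1 h1
    constructor <;> linarith [h6.1, h6.2]
  have hdiff : ∀ δ > 0, (∫ v, stepAt δ 0 v * f t v) - ∫ v, stepAt δ 0 v * f s v ∈
      Icc (-(M * C * δ) * (t - s)) ((lam * K * C + M * C * δ) * (t - s)) := by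
    intro δ hδ
    have hJ := isTest_adjointJ_stepAt (σ := σ) (lam := lam) hδ 0
    obtain ⟨KJ, hKJ⟩ := hJ.exists_bound
    have nKJ := (abs_nonneg _).trans (hKJ 0)
    rw [(weakPairOn_stepAt hf hδ 0).sub_eq hf hW nKJ hJ.continuous.measurable
      (by simpa using hKJ) hs ht]
    have hint := intervalIntegrable_pairing hf hW nKJ hJ.continuous.measurable
      (by simpa using hKJ) hs ht
    have hsub : ∀ r ∈ Icc s t, r ∈ Icc 0 T := fun r hr => ⟨hs.1.trans hr.1, hr.2.trans ht.2⟩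
    constructor
    · have := intervalIntegral.integral_mono_on (f := fun _ => -(M * C * δ)) hst (by simp) hint
        fun r hr => (hgen δ hδ r (hsub r hr)).1
      rw [intervalIntegral.integral_const, smul_eq_mul] at this
      linarith
    · have := intervalIntegral.integral_mono_on (g := fun _ => lam * K * C + M * C * δ) hst hint
        (by simp) fun r hr => (hgen δ hδ r (hsub r hr)).2
      rw [intervalIntegral.integral_const, smul_eq_mul] at this
      linarith
  constructor
  · refine le_of_forall_pos_le_add_mul (Q := M * C * (t - s) + 2 * C) (by positivity)
      fun δ hδ => ?_
    have h1 := (hdiff δ hδ).1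
    have h2 := abs_le.1 (hstep δ hδ s hs)
    have h3 := abs_le.1 (hstep δ hδ t ht)
    nlinarith [h2.1, h2.2, h3.1, h3.2]
  · refine le_of_forall_pos_le_add_mul (Q := M * C * (t - s) + 2 * C) (by positivity)
      fun δ hδ => ?_
    have h1 := (hdiff δ hδ).2
    have h2 := abs_le.1 (hstep δ hδ s hs)
    have h3 := abs_le.1 (hstep δ hδ t ht)
    nlinarith [h2.1, h2.2, h3.1, h3.2]

/-! ### Transport through the origin -/

/-- Differentiability of `A` from an expansion `A r = (r - x) q r + O((r - x) ^ 2)` whose coefficient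
`q` also depends on the time `r`. -/
theorem hasDerivWithinAt_of_quadratic {A q : ℝ → ℝ} {S : Set ℝ} {x K : ℝ} (hx : x ∈ S)
    (hq : ContinuousWithinAt q S x) (h : ∀ r ∈ S, |A r - (r - x) * q r| ≤ K * (r - x) ^ 2) :
    HasDerivWithinAt A (q x) S x := by
  have hA : A x = 0 := by simpa using h x hx
  rw [hasDerivWithinAt_iff_isLittleO]
  have h1 : (fun r => A r - (r - x) * q r) =o[𝓝[S] x] fun r => r - x := by
    refine Asymptotics.IsBigO.trans_isLittleO (g := fun r => (r - x) ^ 2)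
      (Asymptotics.IsBigO.of_bound K ?_) ?_
    · filter_upwards [self_mem_nhdsWithin] with r hr
      simpa using h r hr
    · have : Tendsto (fun r : ℝ => r - x) (𝓝[S] x) (𝓝 0) := by
        have : Continuous fun r : ℝ => r - x := by fun_prop
        simpa using (this.tendsto x).mono_left nhdsWithin_le_nhds
      simpa [sq] using (Asymptotics.isBigO_refl (fun r : ℝ => r - x) (𝓝[S] x)).mul_isLittleO
        ((Asymptotics.isLittleO_one_iff ℝ).2 this)
  have h2 : (fun r => (r - x) * (q r - q x)) =o[𝓝[S] x] fun r => r - x := by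
    have : Tendsto (fun r => q r - q x) (𝓝[S] x) (𝓝 0) := by
      simpa using hq.tendsto.sub_const (q x)
    simpa using (Asymptotics.isBigO_refl (fun r : ℝ => r - x) (𝓝[S] x)).mul_isLittleO
      ((Asymptotics.isLittleO_one_iff ℝ).2 this)
  refine (h1.add h2).congr_left fun r => ?_
  rw [hA, smul_eq_mul]; ring

theorem abs_taylor_two_le {g : ℝ → ℝ} {K : ℝ} (hg : ContDiff ℝ ∞ g)
    (hK : ∀ x, |deriv (deriv g) x| ≤ K) (x η : ℝ) :
    |g (x + η) - g x - η * deriv g x| ≤ K * η ^ 2 := by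
  have h1 : ∀ y, |deriv g y - deriv g x| ≤ K * |y - x| := fun y =>
    convex_univ.norm_image_sub_le_of_norm_deriv_le
      (fun z _ => (hasDerivAt_of_smooth (contDiff_deriv hg) z).differentiableAt)
      (fun z _ => hK z) (mem_univ x) (mem_univ y)
  have nK := (abs_nonneg _).trans (hK 0)
  have h2 := (convex_uIcc x (x + η)).norm_image_sub_le_of_norm_hasDerivWithin_le
    (f := fun y => g y - y * deriv g x) (f' := fun y => deriv g y - 1 * deriv g x)
    (C := K * |η|)
    (fun y _ => ((hasDerivAt_of_smooth hg y).sub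
      ((hasDerivAt_id y).mul_const (deriv g x))).hasDerivWithinAt)
    (fun y hy => by
      rw [one_mul]
      refine (h1 y).trans (mul_le_mul_of_nonneg_left ?_ nK)
      have := abs_sub_left_of_mem_uIcc hy
      simpa using this) left_mem_uIcc right_mem_uIcc
  rw [Real.norm_eq_abs, Real.norm_eq_abs, add_sub_cancel_left, mul_assoc, abs_mul_abs_self] at h2
  rw [sq]
  refine le_trans (le_of_eq ?_) h2
  congr 1
  ring

/-- Along the moving point `c₀ + lam (r - t₀)` the mass to its right changes only by the error term
of `abs_adjointJ_stepAt_sub_le`, up to the width of the step. -/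
theorem IsSolutionOn.abs_transport_le (hf : IsSolutionOn σ lam T f₀ f) (hσ : 0 ≤ σ)
    (hlam : 0 ≤ lam) {C K δ ρ c₀ t₀ t₁ : ℝ} (hδ : 0 < δ)
    (hC : ∀ t ∈ Icc 0 T, ∀ᵐ v, |f t v| ≤ C) (hK : 0 ≤ K)
    (hK₁ : ∀ x, |deriv Real.smoothTransition x| ≤ K)
    (hK₂ : ∀ x, |deriv (deriv Real.smoothTransition) x| ≤ K)
    (ht₀ : 0 ≤ t₀) (ht : t₀ ≤ t₁) (ht₁ : t₁ ≤ T)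
    (hρ : ∀ r ∈ Icc t₀ t₁, |c₀ + lam * (r - t₀)| ≤ ρ) :
    |(∫ v, stepAt δ (c₀ + lam * (t₁ - t₀)) v * f t₁ v) - ∫ v, stepAt δ c₀ v * f t₀ v|
      ≤ (σ / 2 * (δ⁻¹ * ρ + 1) ^ 2 * K + lam * (δ⁻¹ * ρ + 1) * K) * C * δ * (t₁ - t₀) := by
  obtain ⟨C₁, hC₁, hW⟩ := hf.exists_weightBoundOn_one
  have hsub : Icc t₀ t₁ ⊆ Icc 0 T := Icc_subset_Icc ht₀ ht₁
  let c : ℝ → ℝ := fun r => c₀ + lam * (r - t₀)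
  have hδ' : 0 < δ⁻¹ := inv_pos.2 hδ
  have hint : ∀ r ∈ Icc 0 T, ∀ c, Integrable fun v => stepAt δ c v * f r v := fun r hr c =>
    (hf.integrable hr).bdd_mul (c := 1) (contDiff_stepAt δ c).continuous.aestronglyMeasurable
      (ae_of_all _ fun v => abs_stepAt_le δ c v)
  have hint' : ∀ r ∈ Icc 0 T, ∀ c, Integrable fun v => stepDeriv δ c v * f r v := fun r hr c => by
    simpa using (isTest_stepDeriv hδ c).integrable_affine (hf.integrable hr) 1 0
  have hderiv : ∀ r ∈ Icc t₀ t₁, HasDerivWithinAt (fun r => ∫ v, stepAt δ (c r) v * f r v)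
      ((∫ v, adjointJ σ lam (stepAt δ (c r)) v * f r v)
        - lam * δ⁻¹ * ∫ v, stepDeriv δ (c r) v * f r v) (Icc t₀ t₁) r := by
    intro x hx
    have hJ := isTest_adjointJ_stepAt (σ := σ) (lam := lam) hδ (c x)
    have d1 := ((weakPairOn_stepAt hf hδ (c x)).hasDerivWithinAt
      (hJ.continuousOn_pairing hf) (hsub hx)).mono hsub
    -- Moving the step at a fixed time `r`: a second order Taylor expansion, whose first order
    -- coefficient is continuous in `r`.
    have d2 : HasDerivWithinAt
        (fun r => (∫ v, stepAt δ (c r) v * f r v) - ∫ v, stepAt δ (c x) v * f r v)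
        (-(lam * δ⁻¹) * ∫ v, stepDeriv δ (c x) v * f x v) (Icc t₀ t₁) x := by
      refine hasDerivWithinAt_of_quadratic (K := K * (lam * δ⁻¹) ^ 2 * C₁)
        (q := fun r => -(lam * δ⁻¹) * ∫ v, stepDeriv δ (c x) v * f r v) hx ?_ fun r hr => ?_
      · exact ((((isTest_stepDeriv hδ (c x)).continuousOn_pairing hf).mono hsub) x hx).const_mul _
      · have hr' := hsub hr
        have e : (∫ v, stepAt δ (c r) v * f r v) - (∫ v, stepAt δ (c x) v * f r v)
            - (r - x) * (-(lam * δ⁻¹) * ∫ v, stepDeriv δ (c x) v * f r v)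
            = ∫ v, (stepAt δ (c r) v - stepAt δ (c x) v
              - (-(lam * δ⁻¹) * (r - x)) * stepDeriv δ (c x) v) * f r v := by
          have hsub' : Integrable fun v => stepAt δ (c r) v * f r v - stepAt δ (c x) v * f r v :=
            (hint r hr' _).sub (hint r hr' _)
          have e' : ∀ v, (stepAt δ (c r) v - stepAt δ (c x) v
              - (-(lam * δ⁻¹) * (r - x)) * stepDeriv δ (c x) v) * f r v
              = stepAt δ (c r) v * f r v - stepAt δ (c x) v * f r v
                - (-(lam * δ⁻¹) * (r - x)) * (stepDeriv δ (c x) v * f r v) := fun v => by ring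
          simp_rw [e']
          rw [integral_sub hsub' ((hint' r hr' _).const_mul _),
            integral_sub (hint r hr' _) (hint r hr' _), integral_const_mul]
          ring
        rw [e]
        refine (abs_integral_mul_le_of_weight hW (K := K * (lam * δ⁻¹) ^ 2 * (r - x) ^ 2)
          (by positivity) (fun v => ?_) hr').trans (le_of_eq (by ring))
        have h := abs_taylor_two_le Real.smoothTransition.contDiff hK₂
          (δ⁻¹ * v + -(δ⁻¹ * c x)) (-(lam * δ⁻¹) * (r - x))
        have e2 : δ⁻¹ * v + -(δ⁻¹ * c x) + -(lam * δ⁻¹) * (r - x) = δ⁻¹ * v + -(δ⁻¹ * c r) := by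
          simp only [c]; ring
        rw [e2] at h
        refine h.trans (le_of_eq (by ring))
    refine ((d1.add d2).congr_deriv (by ring)).congr_of_mem (fun r _ => ?_) hx
    simp
  have := norm_image_sub_le_of_norm_deriv_le_segment' hderiv (fun r hr => by
    have hr' := hsub (Ico_subset_Icc_self hr)
    exact abs_adjointJ_stepAt_sub_le hσ hlam hδ (hρ r (Ico_subset_Icc_self hr))
      (hf.integrable hr') (hC r hr') hK hK₁ hK₂) t₁ (right_mem_Icc.2 ht)
  simpa [c] using this

/-- The quantitative form of the transport through the origin: the mass to the right of a point at
distance at most `ε` from the origin is, up to `O(ε ^ (3 / 2))`, the mass to the right of the point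
where the characteristic through it, of speed `lam`, has moved at time `t₁`. The width of the step
is taken to be `ε ^ (3 / 2)`. -/
theorem IsSolutionOn.exists_transport_bound (hf : IsSolutionOn σ lam T f₀ f) (hσ : 0 ≤ σ)
    (hlam : 0 < lam) : ∃ Q, ∀ ε ∈ Ioc (0 : ℝ) 1, ∀ c₀ t₀, c₀ ∈ Icc (-ε) 0 → 0 ≤ t₀ →
      t₀ + ε / lam ≤ T →
      |(∫ v in Ioi (c₀ + ε), f (t₀ + ε / lam) v) - ∫ v in Ioi c₀, f t₀ v| ≤ Q * (ε * √ε) := by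
  obtain ⟨C', hC'⟩ := hf.bounded
  obtain ⟨K, hK, hK₁, hK₂⟩ := exists_bound_deriv_smoothTransition
  set C := max C' 0
  have hC : 0 ≤ C := le_max_right _ _
  have hbd : ∀ t ∈ Icc 0 T, ∀ᵐ v, |f t v| ≤ C := fun t ht => by
    filter_upwards [(hC' t ht).2.2] with v hv using hv.trans (le_max_left _ _)
  refine ⟨2 * C + (2 * σ + 2 * lam) * K * C / lam, fun ε hε c₀ t₀ hc₀ ht₀ ht₁ => ?_⟩
  have hε0 : 0 < ε := hε.1
  have hs : 0 < √ε := Real.sqrt_pos.2 hε0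
  have hss : √ε * √ε = ε := Real.mul_self_sqrt hε0.le
  have hs1 : √ε ≤ 1 := Real.sqrt_le_one.2 hε.2
  have hlε : 0 < ε / lam := by positivity
  set δ := ε * √ε with hδdef
  have hδ : 0 < δ := mul_pos hε0 hs
  have hρ : ∀ r ∈ Icc t₀ (t₀ + ε / lam), |c₀ + lam * (r - t₀)| ≤ ε := by
    intro r hr
    have h1 : 0 ≤ lam * (r - t₀) := mul_nonneg hlam.le (sub_nonneg.2 hr.1)
    have h2 : lam * (r - t₀) ≤ ε := by
      have : r - t₀ ≤ ε / lam := by linarith [hr.2]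
      calc _ ≤ lam * (ε / lam) := mul_le_mul_of_nonneg_left this hlam.le
        _ = ε := by field_simp
    rw [abs_le]
    constructor <;> linarith [hc₀.1, hc₀.2]
  have h := hf.abs_transport_le hσ hlam.le hδ hbd hK hK₁ hK₂ ht₀ (by linarith) ht₁ hρ
  have e1 : lam * (t₀ + ε / lam - t₀) = ε := by field_simp; ring
  have e2 : t₀ + ε / lam - t₀ = ε / lam := by ring
  rw [e1, e2] at h
  have h0T : t₀ ∈ Icc 0 T := ⟨ht₀, by linarith⟩
  have h1T : t₀ + ε / lam ∈ Icc 0 T := ⟨by linarith, ht₁⟩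
  have b0 := abs_integral_stepAt_sub_le (c := c₀) hδ (hf.integrable h0T) (hbd _ h0T)
  have b1 := abs_integral_stepAt_sub_le (c := c₀ + ε) hδ (hf.integrable h1T) (hbd _ h1T)
  have e3 : δ⁻¹ * ε = (√ε)⁻¹ := by rw [hδdef]; field_simp
  rw [e3] at h
  have hP : (√ε)⁻¹ + 1 ≤ 2 * (√ε)⁻¹ := by
    have := (one_le_inv₀ hs).2 hs1
    linarith
  have hP2 : (√ε)⁻¹ ≤ (√ε)⁻¹ ^ 2 := by
    have := (one_le_inv₀ hs).2 hs1
    nlinarith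
  have hbound : (σ / 2 * ((√ε)⁻¹ + 1) ^ 2 * K + lam * ((√ε)⁻¹ + 1) * K) * C * δ * (ε / lam)
      ≤ (2 * σ + 2 * lam) * K * C / lam * δ := by
    calc _ ≤ (σ / 2 * (2 * (√ε)⁻¹) ^ 2 * K + lam * (2 * (√ε)⁻¹ ^ 2) * K) * C * δ * (ε / lam) := by
          gcongr
          linarith
      _ = (2 * σ + 2 * lam) * K * C * δ * ((√ε)⁻¹ ^ 2 * ε) / lam := by ring
      _ = _ := by
          have : (√ε)⁻¹ ^ 2 * ε = 1 := by
            rw [inv_pow, Real.sq_sqrt hε0.le, inv_mul_cancel₀ hε0.ne']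
          rw [this]; ring
  have h' := h.trans hbound
  have a0 := abs_le.1 b0
  have a1 := abs_le.1 b1
  have a2 := abs_le.1 h'
  rw [abs_le, add_mul]
  constructor <;> linarith [a0.1, a0.2, a1.1, a1.2, a2.1, a2.2]

/-- Where the mass on the positive half-line is differentiable in time, the value of the solution at
the origin exists and is the derivative divided by the speed `lam`. -/
theorem IsSolution.hasValueAt (hf : IsSolution σ lam f₀ f) (hσ : 0 ≤ σ) (hlam : 0 < lam)
    {s m : ℝ} (hs : 0 < s) (hd : HasDerivAt (fun t => massPos (f t)) m s) :
    HasValueAt (f s) 0 (m / lam) := by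
  have hT : (0 : ℝ) < s + 1 := by linarith
  have hfT := hf (s + 1) hT
  obtain ⟨Q, hQ⟩ := hfT.exists_transport_bound hσ hlam
  have hi : Integrable (f s) := hfT.integrable ⟨hs.le, by linarith⟩
  let D : ℝ → ℝ := fun ε => (2 * ε)⁻¹ * (massPos (f (s + ε / lam)) - massPos (f (s - ε / lam)))
  have hD : Tendsto D (𝓝[>] 0) (𝓝 (m / lam)) := by
    have hp : HasDerivAt (fun ε => massPos (f (s + ε / lam))) (m * (1 / lam)) 0 := by
      have h1 : HasDerivAt (fun ε : ℝ => s + ε / lam) (1 / lam) 0 :=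
        ((hasDerivAt_id (0 : ℝ)).div_const lam).const_add s
      exact HasDerivAt.comp (h₂ := fun t => massPos (f t)) 0 (by simpa using hd) h1
    have hm : HasDerivAt (fun ε => massPos (f (s - ε / lam))) (m * (-(1 / lam))) 0 := by
      have h1 : HasDerivAt (fun ε : ℝ => s - ε / lam) (-(1 / lam)) 0 :=
        ((hasDerivAt_id (0 : ℝ)).div_const lam).const_sub s
      exact HasDerivAt.comp (h₂ := fun t => massPos (f t)) 0 (by simpa using hd) h1
    have h2 := ((hp.sub hm).const_mul (1 / 2)).tendsto_slope_zero_right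
    have e : (1 / 2 : ℝ) * (m * (1 / lam) - m * (-(1 / lam))) = m / lam := by ring
    rw [e] at h2
    refine h2.congr fun ε => ?_
    simp [D]
    ring
  have herr : Tendsto (fun ε : ℝ => Q * √ε) (𝓝[>] 0) (𝓝 0) := by
    have : Continuous fun ε : ℝ => Q * √ε := by fun_prop
    simpa using (this.tendsto 0).mono_left nhdsWithin_le_nhds
  have hdiff : Tendsto (fun ε => ((2 * ε)⁻¹ * ∫ v in (0 - ε)..(0 + ε), f s v) - D ε)
      (𝓝[>] 0) (𝓝 0) := by
    refine squeeze_zero_norm' ?_ herr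
    have ev : Ioo (0 : ℝ) (min 1 (min (lam * s) lam)) ∈ 𝓝[>] (0 : ℝ) :=
      Ioo_mem_nhdsGT (by positivity)
    filter_upwards [ev] with ε hε
    have hε0 : 0 < ε := hε.1
    have hε1 : ε < 1 := hε.2.trans_le (min_le_left _ _)
    have hε2 : ε < lam * s := hε.2.trans_le ((min_le_right _ _).trans (min_le_left _ _))
    have hε3 : ε < lam := hε.2.trans_le ((min_le_right _ _).trans (min_le_right _ _))
    have hq1 : ε / lam < 1 := (div_lt_one hlam).2 hε3
    have hq2 : ε / lam < s := (div_lt_iff₀ hlam).2 (by linarith)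
    -- The mass right of `-ε` is compared with a later time, the mass right of `ε` with an earlier one.
    have h1 := hQ ε ⟨hε0, hε1.le⟩ (-ε) s ⟨le_rfl, by linarith⟩ hs.le (by linarith)
    have h2 := hQ ε ⟨hε0, hε1.le⟩ 0 (s - ε / lam) ⟨by linarith, le_rfl⟩ (by linarith)
      (by linarith)
    have e1 : -ε + ε = 0 := by ring
    have e2 : s - ε / lam + ε / lam = s := by ring
    rw [e1] at h1
    rw [e2, zero_add] at h2
    have e3 : ∫ v in (0 - ε)..(0 + ε), f s v = (∫ v in Ioi (-ε), f s v) - ∫ v in Ioi ε, f s v := by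
      rw [intervalIntegral.integral_Ioi_sub_Ioi hi.integrableOn (by linarith), zero_sub, zero_add]
    rw [e3]
    change |(∫ v in Ioi 0, f (s + ε / lam) v) - ∫ v in Ioi (-ε), f s v| ≤ _ at h1
    have a1 := abs_le.1 h1
    have a2 := abs_le.1 h2
    have e4 : (2 * ε)⁻¹ * ((∫ v in Ioi (-ε), f s v) - ∫ v in Ioi ε, f s v) - D ε
        = (2 * ε)⁻¹ * (((∫ v in Ioi (-ε), f s v) - ∫ v in Ioi ε, f s v)
          - (massPos (f (s + ε / lam)) - massPos (f (s - ε / lam)))) := by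
      simp only [D]; ring
    rw [e4, norm_mul, Real.norm_of_nonneg (by positivity : 0 ≤ (2 * ε)⁻¹)]
    have b : ‖((∫ v in Ioi (-ε), f s v) - ∫ v in Ioi ε, f s v)
          - (massPos (f (s + ε / lam)) - massPos (f (s - ε / lam)))‖ ≤ 2 * (Q * (ε * √ε)) := by
      rw [Real.norm_eq_abs, abs_le]
      unfold massPos
      constructor <;> linarith [a1.1, a1.2, a2.1, a2.2]
    calc _ ≤ (2 * ε)⁻¹ * (2 * (Q * (ε * √ε))) := mul_le_mul_of_nonneg_left b (by positivity)
      _ = Q * √ε := by field_simp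
  have := hdiff.add hD
  simpa [HasValueAt] using this

/-! ### The mean on the negative half-line -/

/-- A smooth approximation of the negative part of the identity. -/
noncomputable def smoothNeg (ε v : ℝ) : ℝ := (smoothAbs ε v - v) / 2

theorem hasDerivAt_smoothNeg {ε : ℝ} (hε : 0 < ε) (v : ℝ) :
    HasDerivAt (smoothNeg ε) ((v / smoothAbs ε v - 1) / 2) v :=
  ((hasDerivAt_smoothAbs hε v).sub (hasDerivAt_id v)).div_const 2

theorem hasDerivAt_deriv_smoothNeg {ε : ℝ} (hε : 0 < ε) (v : ℝ) :
    HasDerivAt (fun v => (v / smoothAbs ε v - 1) / 2) (ε ^ 2 / smoothAbs ε v ^ 3 / 2) v :=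
  ((hasDerivAt_div_smoothAbs hε v).sub_const 1).div_const 2

theorem contDiff_smoothNeg {ε : ℝ} (hε : 0 < ε) : ContDiff ℝ ∞ (smoothNeg ε) :=
  ((contDiff_smoothAbs hε).sub contDiff_id).div_const 2

theorem sq_mul_deriv_deriv_smoothNeg_le {ε : ℝ} (hε : 0 < ε) (v : ℝ) :
    v ^ 2 * (ε ^ 2 / smoothAbs ε v ^ 3 / 2) ≤ ε := by
  have hp := smoothAbs_pos hε v
  have hv : v ^ 2 ≤ smoothAbs ε v ^ 2 := by rw [smoothAbs_sq]; nlinarith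
  have h1 := le_smoothAbs ε v
  rw [div_div, mul_div_assoc', div_le_iff₀ (by positivity)]
  calc v ^ 2 * ε ^ 2 ≤ smoothAbs ε v ^ 2 * (smoothAbs ε v * ε) := by
        gcongr; rw [sq]; gcongr
    _ ≤ ε * (smoothAbs ε v ^ 3 * 2) := by nlinarith [mul_pos hε (pow_pos hp 3)]

theorem tendsto_smoothAbs {a : ℕ → ℝ} (ha : Tendsto a atTop (𝓝 0)) (v : ℝ) :
    Tendsto (fun n => smoothAbs (a n) v) atTop (𝓝 |v|) := by
  have : Continuous fun ε => smoothAbs ε v := by unfold smoothAbs; fun_prop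
  have h := (this.tendsto 0).comp ha
  rwa [show smoothAbs 0 v = |v| by simp [smoothAbs, Real.sqrt_sq_eq_abs]] at h

/-- The weak equation for the negative part of `v`: the diffusion term vanishes in the limit because
`v ^ 2` kills the singular second derivative at the origin. -/
theorem IsSolutionOn.weakPairOn_negPart (hf : IsSolutionOn σ lam T f₀ f) {C : ℝ}
    (hW : WeightBoundOn T f (smoothAbs 1) C) :
    WeakPairOn T f (fun v => (|v| - v) / 2) ((Iio 0).indicator fun v => lam * (v - 1)) := by
  let a : ℕ → ℝ := fun n => 1 / ((n : ℝ) + 1)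
  have ha : Tendsto a atTop (𝓝 0) := tendsto_one_div_add_atTop_nhds_zero_nat
  have ha0 : ∀ n, 0 < a n := fun n => by positivity
  have ha1 : ∀ n, a n ≤ 1 := fun n => by
    rw [div_le_one (by positivity)]; linarith [Nat.cast_nonneg (α := ℝ) n]
  have e1 : ∀ n, deriv (smoothNeg (a n)) = fun v => (v / smoothAbs (a n) v - 1) / 2 := fun n =>
    funext fun v => (hasDerivAt_smoothNeg (ha0 n) v).deriv
  have b0 : ∀ n v, |smoothNeg (a n) v| ≤ 2 * smoothAbs 1 v := fun n v => by
    have h1 := smoothAbs_le (ha0 n).le v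
    have h2 := abs_le.1 (abs_le_smoothAbs (a n) v)
    have h3 := abs_le_smoothAbs 1 v
    have h4 := le_smoothAbs 1 v
    have h5 := neg_abs_le v
    rw [smoothNeg, abs_of_nonneg (by linarith)]
    linarith [ha1 n]
  have b1 : ∀ n v, (1 + |v|) * |deriv (smoothNeg (a n)) v| ≤ 2 * smoothAbs 1 v := fun n v => by
    have h3 := abs_le_smoothAbs 1 v
    have h4 := le_smoothAbs 1 v
    have h5 := abs_le.1 (abs_div_smoothAbs_le (a n) v)
    have h6 : |deriv (smoothNeg (a n)) v| ≤ 1 := by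
      rw [e1, abs_le]; constructor <;> linarith [h5.1, h5.2]
    calc _ ≤ (1 + |v|) * 1 := mul_le_mul_of_nonneg_left h6 (by positivity)
      _ ≤ _ := by linarith
  have b2 : ∀ n v, v ^ 2 * |deriv (deriv (smoothNeg (a n))) v| ≤ 2 * smoothAbs 1 v := fun n v => by
    have hp := smoothAbs_pos (ha0 n) v
    rw [e1, (hasDerivAt_deriv_smoothNeg (ha0 n) v).deriv, abs_of_nonneg (by positivity)]
    linarith [sq_mul_deriv_deriv_smoothNeg_le (ha0 n) v, ha1 n, le_smoothAbs 1 v]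
  refine WeakPairOn.of_tendsto (φs := fun n => smoothNeg (a n))
    (gs := fun n => adjointJ σ lam (smoothNeg (a n)))
    (K := 2 + (|σ / 2| + |lam|) * 2) hf hW (by positivity)
    (fun n => weakPairOn_of_weight hf hW (contDiff_smoothNeg (ha0 n)) zero_le_two (b0 n) (b1 n)
      (b2 n))
    (fun n => (contDiff_smoothNeg (ha0 n)).continuous.measurable)
    (fun n => measurable_adjointJ (contDiff_smoothNeg (ha0 n))) (fun n v => ?_) (fun n v => ?_)
    (ae_of_all _ fun v => ((tendsto_smoothAbs ha v).sub_const v).div_const 2) ?_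
  · have hp := smoothAbs_pos one_pos v
    refine (b0 n v).trans (mul_le_mul_of_nonneg_right ?_ hp.le)
    linarith [show 0 ≤ (|σ / 2| + |lam|) * 2 by positivity]
  · have hp := smoothAbs_pos one_pos v
    refine (abs_adjointJ_le (b1 n) (b2 n) v).trans (mul_le_mul_of_nonneg_right ?_ hp.le)
    linarith
  · filter_upwards [Measure.ae_ne volume (0 : ℝ)] with v hv
    have t1 : Tendsto (fun n => v ^ 2 * (a n ^ 2 / smoothAbs (a n) v ^ 3 / 2)) atTop (𝓝 0) := by
      refine squeeze_zero (fun n => ?_) (fun n => sq_mul_deriv_deriv_smoothNeg_le (ha0 n) v) ha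
      have hp := smoothAbs_pos (ha0 n) v
      positivity
    have t2 : Tendsto (fun n => v / smoothAbs (a n) v) atTop (𝓝 (v / |v|)) :=
      tendsto_const_nhds.div (tendsto_smoothAbs ha v) (abs_ne_zero.2 hv)
    have t3 := (t1.const_mul (σ / 2)).sub (((t2.sub_const 1).div_const 2).const_mul (lam * (v - 1)))
    have e2 : σ / 2 * 0 - lam * (v - 1) * ((v / |v| - 1) / 2)
        = (Iio 0).indicator (fun v => lam * (v - 1)) v := by
      rcases lt_or_gt_of_ne hv with h | h
      · rw [indicator_of_mem (by exact h), abs_of_neg h, div_neg, div_self hv]; ring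
      · rw [indicator_of_notMem (by simpa using h.le), abs_of_pos h, div_self hv]; ring
    rw [e2] at t3
    refine t3.congr fun n => ?_
    rw [adjointJ_eq (hasDerivAt_smoothNeg (ha0 n)) (hasDerivAt_deriv_smoothNeg (ha0 n))]
    ring

theorem abs_meanNeg_eq {h : ℝ → ℝ} (hh : ∀ᵐ v, 0 ≤ h v) :
    |meanNeg h| = ∫ v, (|v| - v) / 2 * h v := by
  have e : meanNeg h = -∫ v, (|v| - v) / 2 * h v := by
    rw [meanNeg, ← integral_indicator measurableSet_Iio, ← integral_neg]
    refine integral_congr_ae (ae_of_all _ fun v => ?_)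
    rcases lt_or_ge v 0 with h1 | h1
    · simp only [indicator_of_mem (show v ∈ Iio (0 : ℝ) from h1), abs_of_neg h1]; ring
    · simp only [indicator_of_notMem (show v ∉ Iio (0 : ℝ) from not_lt.2 h1), abs_of_nonneg h1]
      ring
  rw [e, abs_neg, abs_of_nonneg]
  refine integral_nonneg_of_ae ?_
  filter_upwards [hh] with v hv
  exact mul_nonneg (by linarith [le_abs_self v]) hv

/-- The negative part of the mean is dissipated at rate at least `lam`, in the form of an implicit
Euler inequality. -/
theorem IsSolutionOn.abs_meanNeg_mul_le (hf : IsSolutionOn σ lam T f₀ f) (hσ : 0 ≤ σ)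
    (hlam : 0 ≤ lam) (h0 : IsUnitMeanDensity (f 0)) {s t : ℝ} (hs : 0 ≤ s) (hst : s ≤ t)
    (ht : t ≤ T) : |meanNeg (f t)| * (1 + lam * (t - s)) ≤ |meanNeg (f s)| := by
  obtain ⟨C, hC, hW⟩ := hf.exists_weightBoundOn_smoothAbs hσ hlam h0
  have hpos := fun r (hr : r ∈ Icc 0 T) => hf.ae_nonneg hσ hlam h0.nonneg hr
  have hb : ∀ v : ℝ, |(|v| - v) / 2| ≤ 1 * smoothAbs 1 v := fun v => by
    rw [abs_of_nonneg (by linarith [le_abs_self v])]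
    linarith [neg_abs_le v, abs_le_smoothAbs 1 v]
  have hm : Measurable fun v : ℝ => (|v| - v) / 2 := by fun_prop
  have hgm : Measurable ((Iio (0 : ℝ)).indicator fun v => lam * (v - 1)) :=
    Measurable.indicator (by fun_prop) measurableSet_Iio
  have hgb : ∀ v, |(Iio (0 : ℝ)).indicator (fun v => lam * (v - 1)) v|
      ≤ (lam * 2) * smoothAbs 1 v := fun v => by
    have hp := smoothAbs_pos one_pos v
    by_cases hv : v ∈ Iio (0 : ℝ)
    · rw [indicator_of_mem hv, abs_mul, abs_of_nonneg hlam, mul_assoc]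
      refine mul_le_mul_of_nonneg_left ?_ hlam
      have := abs_sub v 1
      rw [abs_one] at this
      linarith [abs_le_smoothAbs 1 v, le_smoothAbs 1 v]
    · rw [indicator_of_notMem hv, abs_zero]; positivity
  let N : ℝ → ℝ := fun r => ∫ v, (|v| - v) / 2 * f r v
  let G : ℝ → ℝ := fun r => ∫ v, (Iio (0 : ℝ)).indicator (fun v => lam * (v - 1)) v * f r v
  have hN : ∀ r ∈ Icc 0 T, |meanNeg (f r)| = N r := fun r hr => abs_meanNeg_eq (hpos r hr)
  have hG : ∀ r ∈ Icc 0 T, G r ≤ -lam * N r := by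
    intro r hr
    simp only [G, N]
    rw [← integral_const_mul]
    refine integral_mono_ae (integrable_mul_of_weight hf hW hgm hgb hr)
      ((integrable_mul_of_weight hf hW hm hb hr).const_mul _) ?_
    filter_upwards [hpos r hr] with v hv
    rw [← mul_assoc]
    refine mul_le_mul_of_nonneg_right ?_ hv
    rcases lt_or_ge v 0 with h1 | h1
    · rw [indicator_of_mem (show v ∈ Iio (0 : ℝ) from h1), abs_of_neg h1]; nlinarith
    · rw [indicator_of_notMem (show v ∉ Iio (0 : ℝ) from not_lt.2 h1), abs_of_nonneg h1]; simp
  have hN0 : ∀ r ∈ Icc 0 T, 0 ≤ N r := fun r hr => by rw [← hN r hr]; exact abs_nonneg _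
  have hwp := hf.weakPairOn_negPart hW
  have hdiff : ∀ s ∈ Icc 0 T, ∀ t ∈ Icc 0 T, N t - N s = ∫ r in s..t, G r := fun s hs t ht =>
    hwp.sub_eq hf hW (by positivity) hgm hgb hs ht
  have hint : ∀ s ∈ Icc 0 T, ∀ t ∈ Icc 0 T, IntervalIntegrable G volume s t := fun s hs t ht =>
    intervalIntegrable_pairing hf hW (by positivity) hgm hgb hs ht
  have hanti : ∀ s ∈ Icc 0 T, ∀ t ∈ Icc 0 T, s ≤ t → N t ≤ N s := by
    intro s hs t ht hst
    have := intervalIntegral.integral_mono_on (g := fun _ => (0 : ℝ)) hst (hint s hs t ht) (by simp)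
      fun r hr => by
        have hr' : r ∈ Icc 0 T := ⟨hs.1.trans hr.1, hr.2.trans ht.2⟩
        exact (hG r hr').trans (by nlinarith [mul_nonneg hlam (hN0 r hr')])
    rw [← hdiff s hs t ht] at this
    simp at this
    linarith
  have hsT : s ∈ Icc 0 T := ⟨hs, hst.trans ht⟩
  have htT : t ∈ Icc 0 T := ⟨hs.trans hst, ht⟩
  have := intervalIntegral.integral_mono_on (g := fun _ => -lam * N t) hst (hint s hsT t htT)
    (by simp) fun r hr => by
      have hr' : r ∈ Icc 0 T := ⟨hs.trans hr.1, hr.2.trans ht⟩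
      exact (hG r hr').trans (by nlinarith [mul_le_mul_of_nonneg_left (hanti r hr' t htT hr.2) hlam])
  rw [← hdiff s hsT t htT, intervalIntegral.integral_const, smul_eq_mul] at this
  rw [hN t htT, hN s hsT]
  linarith

/-- An implicit Euler inequality on all time steps gives exponential decay. -/
theorem mul_exp_le_of_implicit_euler {N : ℝ → ℝ} {c : ℝ} (hc : 0 ≤ c)
    (h : ∀ s t, 0 ≤ s → s ≤ t → N t * (1 + c * (t - s)) ≤ N s) {t : ℝ} (ht : 0 ≤ t) :
    N t * Real.exp (c * t) ≤ N 0 := by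
  have hstep : ∀ x, 0 ≤ x → ∀ k : ℕ, N (k * x) * (1 + c * x) ^ k ≤ N 0 := by
    intro x hx k
    induction k with
    | zero => simp
    | succ k ih =>
      have h1 := h (k * x) ((k + 1 : ℕ) * x) (by positivity) (by push_cast; nlinarith)
      have e : ((k + 1 : ℕ) : ℝ) * x - k * x = x := by push_cast; ring
      rw [e] at h1
      calc N ((k + 1 : ℕ) * x) * (1 + c * x) ^ (k + 1)
          = N ((k + 1 : ℕ) * x) * (1 + c * x) * (1 + c * x) ^ k := by ring
        _ ≤ N (k * x) * (1 + c * x) ^ k := mul_le_mul_of_nonneg_right h1 (by positivity)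
        _ ≤ N 0 := ih
  refine le_of_tendsto ((Real.tendsto_one_add_div_pow_exp (c * t)).const_mul (N t)) ?_
  filter_upwards [eventually_gt_atTop 0] with n hn
  have hn' : (n : ℝ) ≠ 0 := by exact_mod_cast hn.ne'
  have h1 := hstep (t / n) (by positivity) n
  rwa [mul_div_cancel₀ _ hn', ← mul_div_assoc] at h1

/-! ### The global statement -/

theorem IsUnitMeanDensity.congr {g h : ℝ → ℝ} (hg : IsUnitMeanDensity g) (e : h =ᵐ[volume] g) :
    IsUnitMeanDensity h := by
  have e' : (fun v => v * h v) =ᵐ[volume] fun v => v * g v := by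
    filter_upwards [e] with v hv
    rw [hv]
  refine ⟨?_, hg.integrable.congr e.symm, (integral_congr_ae e).trans hg.mass,
    hg.integrable_mul.congr e'.symm, (integral_congr_ae e').trans hg.mean⟩
  filter_upwards [hg.nonneg, e] with v h1 h2
  rwa [h2]

end WealthFP

theorem theorem2p4 (σ lam : ℝ) (hσ : 0 < σ) (hlam : 0 < lam)
    (f₀ : ℝ → ℝ) (hf₀ : WealthFP.IsUnitMeanDensity f₀) (hf₀_bdd : MemLp f₀ ⊤)
    (f : ℝ → ℝ → ℝ) (hf : WealthFP.IsSolution σ lam f₀ f) :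
    -- the solution stays a probability density with unit mean
    (∀ t : ℝ, 0 ≤ t → WealthFP.IsUnitMeanDensity (f t)) ∧
    -- the mass on the positive half-line is nondecreasing
    MonotoneOn (fun t => WealthFP.massPos (f t)) (Ici 0) ∧
    -- the function `a` is the value at `v = 0` of the solution, as a function of time
    (∃ a : ℝ → ℝ,
      (∀ᵐ s ∂(volume.restrict (Ioi (0 : ℝ))), WealthFP.HasValueAt (f s) 0 (a s)) ∧
      ∀ t : ℝ, 0 ≤ t → IntervalIntegrable a volume 0 t ∧
        WealthFP.massPos (f t) = WealthFP.massPos (f 0) + lam * ∫ s in 0..t, a s) ∧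
    -- the negative part of the mean decreases in absolute value, exponentially fast
    AntitoneOn (fun t => |WealthFP.meanNeg (f t)|) (Ici 0) ∧
    ∀ t : ℝ, 0 ≤ t →
      |WealthFP.meanNeg (f t)| ≤ |WealthFP.meanNeg (f 0)| * Real.exp (-(lam * t)) := by
  have h0 : WealthFP.IsUnitMeanDensity (f 0) :=
    hf₀.congr ((hf 1 one_pos).initial_ae_eq zero_le_one hf₀.integrable)
  have hdens : ∀ t, 0 ≤ t → WealthFP.IsUnitMeanDensity (f t) := fun t ht =>
    (hf (t + 1) (by linarith)).isUnitMeanDensity hσ.le hlam.le h0 ⟨ht, by linarith⟩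
  have hlip : ∀ T, 0 < T → ∃ L, 0 ≤ L ∧ ∀ s ∈ Icc 0 T, ∀ t ∈ Icc 0 T, s ≤ t →
      WealthFP.massPos (f t) - WealthFP.massPos (f s) ∈ Icc 0 (L * (t - s)) := fun T hT =>
    (hf T hT).massPos_sub_mem hσ.le hlam.le fun t ht => (hdens t ht.1).nonneg
  have hmono : MonotoneOn (fun t => WealthFP.massPos (f t)) (Ici 0) := by
    intro s hs t ht hst
    obtain ⟨L, -, hL⟩ := hlip (t + 1) (by linarith [mem_Ici.1 ht])
    have := (hL s ⟨hs, by linarith⟩ t ⟨ht, by linarith⟩ hst).1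
    simp only
    linarith
  have heuler : ∀ s t, 0 ≤ s → s ≤ t →
      |WealthFP.meanNeg (f t)| * (1 + lam * (t - s)) ≤ |WealthFP.meanNeg (f s)| :=
    fun s t hs hst => (hf (t + 1) (by linarith)).abs_meanNeg_mul_le hσ.le hlam.le h0 hs hst
      (by linarith)
  refine ⟨hdens, hmono, ⟨fun s => deriv (fun t => WealthFP.massPos (f t)) s / lam, ?_, ?_⟩, ?_, ?_⟩
  · filter_upwards [hmono.ae_differentiableWithinAt measurableSet_Ici |>.filter_mono
      (ae_mono (Measure.restrict_mono Ioi_subset_Ici_self le_rfl)),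
      ae_restrict_mem measurableSet_Ioi] with s hs hs0
    exact hf.hasValueAt hσ.le hlam hs0 (hs.differentiableAt (Ici_mem_nhds hs0)).hasDerivAt
  · intro t ht
    obtain ⟨L, hL0, hL⟩ := hlip (t + 1) (by linarith)
    have hLip : LipschitzOnWith (Real.toNNReal L) (fun t => WealthFP.massPos (f t)) (uIcc 0 t) := by
      rw [uIcc_of_le ht]
      refine LipschitzOnWith.of_dist_le_mul fun x hx y hy => ?_
      rw [Real.coe_toNNReal _ hL0]
      have hx' : x ∈ Icc 0 (t + 1) := ⟨hx.1, by linarith [hx.2]⟩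
      have hy' : y ∈ Icc 0 (t + 1) := ⟨hy.1, by linarith [hy.2]⟩
      rcases le_total x y with h | h
      · have := hL x hx' y hy' h
        rw [dist_comm, dist_comm x, Real.dist_eq, Real.dist_eq, abs_of_nonneg this.1,
          abs_of_nonneg (sub_nonneg.2 h)]
        exact this.2
      · have := hL y hy' x hx' h
        rw [Real.dist_eq, Real.dist_eq, abs_of_nonneg this.1, abs_of_nonneg (sub_nonneg.2 h)]
        exact this.2
    have hac := hLip.absolutelyContinuousOnInterval
    refine ⟨hac.intervalIntegrable_deriv.div_const lam, ?_⟩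
    rw [intervalIntegral.integral_div, hac.integral_deriv_eq_sub, mul_div_cancel₀ _ hlam.ne']
    ring
  · intro s hs t ht hst
    have h1 := heuler s t hs hst
    have h2 : 0 ≤ |WealthFP.meanNeg (f t)| * (lam * (t - s)) :=
      mul_nonneg (abs_nonneg _) (mul_nonneg hlam.le (sub_nonneg.2 hst))
    simp only
    linarith
  · intro t ht
    have := WealthFP.mul_exp_le_of_implicit_euler (N := fun t => |WealthFP.meanNeg (f t)|)
      hlam.le heuler ht
    rw [Real.exp_neg, ← div_eq_mul_inv, le_div_iff₀ (Real.exp_pos _)]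
    exact this
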